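/- **Setting.** Let $\rho>0$ and let $G$ be a locally integrable completely monotonic (LICM) relaxation modulus, not identically zero: $G$ is $C^\infty$ on $]0,\infty[$, $(-1)^n G^{(n)}\ge 0$ there for all $n\ge 0$, and $G$ is integrable near $0$. For $\Re p>0$ put $$Q(p)=p\,\tilde G(p)=p\int_0^\infty e^{-pt}G(t)\,dt,\qquad \kappa(p)=\rho^{1/2}\,p\,/\,Q(p)^{1/2}$$ with the principal square root (the branch with $\Re\kappa\ge 0$). Let $B\ge 0$ be the linear coefficient in the decomposition $\kappa(p)=Bp+\beta(p)$, that is, $B=\lim_{p\to+\infty}\kappa(p)/p$ along the positive reals; in the representation $\beta(p)=p\int_{]0,\infty[}\nu(dr)/(p+r)$ with $\int_{]0,\infty[}\nu(dr)/(1+r)<\infty$ this is the same $B$ and the same $\beta$. The wavefront speed is $c_\infty=1/B\in\,]0,\infty]$. For $\varepsilon>0$ the one-dimensional Green's function is the Bromwich integral $$u^{(1)}(t,x)=\frac1{4\pi i}\int_{-i\infty+\varepsilon}^{i\infty+\varepsilon}e^{pt}\,\frac{\rho}{Q(p)\,\kappa(p)}\,e^{-\kappa(p)|x|}\,dp ,$$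 understood as an improper integral in which the two ends go to infinity independently, and, for $\mathbf x\in\mathbb R^3\setminus\{0\}$, the three-dimensional Green's function is $$u^{(3)}(t,\mathbf x)=-\left.\frac1{2\pi r}\frac{\partial}{\partial r}u^{(1)}(t,r)\right|_{r=|\mathbf x|}.$$ **Theorem.** Assume $c_\infty<\infty$. 1. For every $r\ge 0$ the function $f(p)=[Q(p)\kappa(p)]^{-1}e^{-\beta(p)r}$ is analytic in the open right half-plane, extends continuously to $\{\Re p\ge 0,\ p\ne 0\}$, and tends to $0$ as $|p|\to\infty$, uniformly with respect to $\arg p\in[-\pi/2,\pi/2]$. 2. For every $\varepsilon>0$ and all real $t,x$ with $t<|x|/c_\infty$, the Bromwich integral converges and $u^{(1)}(t,x)=0$. 3. For every $\varepsilon>0$, $t\in\mathbb R$ and $\mathbf x\in\mathbb R^3\setminus\{0\}$ with $t<|\mathbf x|/c_\infty$, the function $u^{(1)}(t,\cdot)$ is differentiable at $r=|\mathbf x|$ and $u^{(3)}(t,\mathbf x)=0$. -/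

import Mathlib

open Set Filter Topology MeasureTheory

namespace Viscoelastic

noncomputable section

/-- Complete monotonicity on the open half-line `]0, ∞[`: the function is smooth there and
`(-1)ⁿ Dⁿ f ≥ 0` for all `n`. -/
def CompletelyMonotonic (f : ℝ → ℝ) : Prop :=
  ContDiffOn ℝ ((⊤ : ℕ∞) : WithTop ℕ∞) f (Ioi 0) ∧
    ∀ n : ℕ, ∀ x : ℝ, 0 < x → 0 ≤ (-1 : ℝ) ^ n * iteratedDeriv n f x

/-- Locally integrable completely monotonic functions (LICM). Only the values on `]0, ∞[` matter;
local integrability is on `[0, ∞[`, that is, it includes a neighbourhood of `0`. -/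
def LICM (f : ℝ → ℝ) : Prop :=
  CompletelyMonotonic f ∧ LocallyIntegrableOn f (Ici 0) volume

/-- The Laplace transform `∫_0^∞ e^{-p t} G(t) dt`. -/
def laplace (G : ℝ → ℝ) (p : ℂ) : ℂ :=
  ∫ t in Ioi (0 : ℝ), Complex.exp (-(p * (t : ℂ))) * (G t : ℂ)

/-- The complex modulus `Q(p) = p G̃(p)`. -/
def modulusQ (G : ℝ → ℝ) (p : ℂ) : ℂ :=
  p * laplace G p

/-- The complex wave number function `κ(p) = ρ^{1/2} p / Q(p)^{1/2}`. The root is the principal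
one; for a completely monotonic `G` the values of `Q` on the right half-plane lie in the right
half-plane and `arg Q(p)` lies between `0` and `arg p`, so this is the branch with `Re κ ≥ 0`. -/
def waveNumber (ρ : ℝ) (G : ℝ → ℝ) (p : ℂ) : ℂ :=
  (Real.sqrt ρ : ℂ) * p / Complex.sqrt (modulusQ G p)

/-- The coefficient `B` of the linear part in `κ(p) = B p + β(p)`, i.e. the limit of `κ(p) / p`
as `p → ∞` along the positive reals (on which `κ` is real). -/
def linearCoeff (ρ : ℝ) (G : ℝ → ℝ) : ℝ :=
  limUnder atTop (fun p : ℝ => (waveNumber ρ G (p : ℂ)).re / p)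

/-- The dispersion-attenuation function `β(p) = κ(p) - B p`. -/
def dispAtt (ρ : ℝ) (G : ℝ → ℝ) (p : ℂ) : ℂ :=
  waveNumber ρ G p - (linearCoeff ρ G : ℂ) * p

/-- The wavefront speed `c_∞ = 1 / B ∈ ]0, ∞]`, equal to `∞` when `B = 0`. -/
def wavefrontSpeed (ρ : ℝ) (G : ℝ → ℝ) : ENNReal :=
  (ENNReal.ofReal (linearCoeff ρ G))⁻¹

/-- `κ(p) = B p + p ∫_{]0,∞[} ν(dr) / (p + r)` on the right half-plane, with `B ≥ 0` and `ν` a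
positive Radon measure satisfying `∫_{]0,∞[} ν(dr) / (1 + r) < ∞`. -/
def IsSpectralRepresentation (ρ : ℝ) (G : ℝ → ℝ) (B : ℝ) (ν : Measure ℝ) : Prop :=
  0 ≤ B ∧ IsLocallyFiniteMeasure ν ∧ IntegrableOn (fun r : ℝ => 1 / (1 + r)) (Ioi 0) ν ∧
    ∀ p : ℂ, 0 < p.re →
      waveNumber ρ G p = (B : ℂ) * p + p * ∫ r in Ioi (0 : ℝ), 1 / (p + (r : ℂ)) ∂ν

/-- In every spectral representation of `κ` the linear coefficient is `linearCoeff`. -/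
theorem linearCoeff_eq {ρ : ℝ} {G : ℝ → ℝ} {B : ℝ} {ν : Measure ℝ}
    (h : IsSpectralRepresentation ρ G B ν) : linearCoeff ρ G = B := by
  obtain ⟨-, -, hint, hrep⟩ := h
  have h0 : Tendsto (fun p : ℝ => ∫ r in Ioi (0 : ℝ), 1 / ((p : ℂ) + (r : ℂ)) ∂ν) atTop
      (𝓝 (∫ _r in Ioi (0 : ℝ), (0 : ℂ) ∂ν)) := by
    refine tendsto_integral_filter_of_dominated_convergence (fun r : ℝ => 1 / (1 + r)) ?_ ?_ hint ?_
    · refine Eventually.of_forall fun p => ?_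
      exact (Measurable.const_div (by fun_prop) _).aestronglyMeasurable
    · filter_upwards [eventually_ge_atTop (1 : ℝ)] with p hp
      refine (ae_restrict_iff' measurableSet_Ioi).2 (Eventually.of_forall fun r hr => ?_)
      have hr' : (0 : ℝ) < r := hr
      have e : (1 : ℂ) / ((p : ℂ) + (r : ℂ)) = ((1 / (p + r) : ℝ) : ℂ) := by push_cast; rfl
      rw [e, Complex.norm_real, Real.norm_of_nonneg (by positivity)]
      exact one_div_le_one_div_of_le (by positivity) (by linarith)
    · refine Eventually.of_forall fun r => ?_
      have e : (fun p : ℝ => (1 : ℂ) / ((p : ℂ) + (r : ℂ))) =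
          fun p : ℝ => (((p + r)⁻¹ : ℝ) : ℂ) := by
        funext p; push_cast; rw [one_div]
      rw [e]
      have := (tendsto_inv_atTop_zero.comp (tendsto_atTop_add_const_right atTop r tendsto_id))
      exact_mod_cast (Complex.continuous_ofReal.tendsto 0).comp this
  rw [integral_zero] at h0
  have h1 : Tendsto (fun p : ℝ => (waveNumber ρ G (p : ℂ)).re / p) atTop (𝓝 B) := by
    have h2 := (Complex.continuous_re.tendsto 0).comp h0
    have h3 := h2.const_add B
    simp only [Complex.zero_re, add_zero] at h3
    refine h3.congr' ?_
    filter_upwards [eventually_gt_atTop (0 : ℝ)] with p hp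
    rw [hrep p (by simpa using hp)]
    simp only [Function.comp, Complex.add_re, Complex.re_ofReal_mul, Complex.ofReal_re]
    field_simp
  exact h1.limUnder_eq

/-- In every spectral representation of `κ` the integral term is `dispAtt`. -/
theorem dispAtt_eq {ρ : ℝ} {G : ℝ → ℝ} {B : ℝ} {ν : Measure ℝ}
    (h : IsSpectralRepresentation ρ G B ν) {p : ℂ} (hp : 0 < p.re) :
    dispAtt ρ G p = p * ∫ r in Ioi (0 : ℝ), 1 / (p + (r : ℂ)) ∂ν := by
  rw [dispAtt, linearCoeff_eq h, h.2.2.2 p hp]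
  ring

/-- `∫_{ε - i∞}^{ε + i∞} F(p) dp` converges, with both ends going to infinity independently, and
has the value `v`. -/
def HasBromwichIntegral (ε : ℝ) (F : ℂ → ℂ) (v : ℂ) : Prop :=
  Tendsto (fun R : ℝ × ℝ =>
      ∫ y in (-R.1)..R.2, F ((ε : ℂ) + Complex.I * (y : ℂ)) * Complex.I)
    (atTop ×ˢ atTop) (𝓝 v)

/-- The value of the Bromwich integral `∫_{ε - i∞}^{ε + i∞} F(p) dp`. -/
def bromwich (ε : ℝ) (F : ℂ → ℂ) : ℂ :=
  limUnder (atTop ×ˢ atTop) (fun R : ℝ × ℝ =>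
    ∫ y in (-R.1)..R.2, F ((ε : ℂ) + Complex.I * (y : ℂ)) * Complex.I)

/-- The integrand `e^{p t} ρ / (Q(p) κ(p)) e^{-κ(p) |x|}`. -/
def greenIntegrand (ρ : ℝ) (G : ℝ → ℝ) (t x : ℝ) (p : ℂ) : ℂ :=
  Complex.exp (p * (t : ℂ)) * ((ρ : ℂ) / (modulusQ G p * waveNumber ρ G p)) *
    Complex.exp (-(waveNumber ρ G p * ((|x| : ℝ) : ℂ)))

/-- The one-dimensional Green's function, with Bromwich abscissa `ε`. -/
def greenOneD (ρ : ℝ) (G : ℝ → ℝ) (ε t x : ℝ) : ℂ :=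
  1 / (4 * (Real.pi : ℂ) * Complex.I) * bromwich ε (greenIntegrand ρ G t x)

/-- The three-dimensional Green's function
`u⁽³⁾(t, x) = - (1 / (2 π r)) ∂u⁽¹⁾(t, r)/∂r` at `r = |x|`. -/
def greenThreeD (ρ : ℝ) (G : ℝ → ℝ) (ε t : ℝ) (x : EuclideanSpace ℝ (Fin 3)) : ℂ :=
  -(1 / (2 * (Real.pi : ℂ) * ((‖x‖ : ℝ) : ℂ)) *
    deriv (fun r : ℝ => greenOneD ρ G ε t r) ‖x‖)

/-- The open right half-plane. -/
def rightHalfPlane : Set ℂ := {p : ℂ | 0 < p.re}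

/-- The function `f(p) = [Q(p) κ(p)]⁻¹ e^{-β(p) r}`. -/
def frontFactor (ρ : ℝ) (G : ℝ → ℝ) (r : ℝ) (p : ℂ) : ℂ :=
  (modulusQ G p * waveNumber ρ G p)⁻¹ * Complex.exp (-(dispAtt ρ G p * (r : ℂ)))

/-- The continuous extension of `frontFactor` from the open right half-plane up to the imaginary
axis, where the Laplace integral itself need not converge. -/
def frontFactorExt (ρ : ℝ) (G : ℝ → ℝ) (r : ℝ) : ℂ → ℂ :=
  extendFrom rightHalfPlane (frontFactor ρ G r)

end

end Viscoelastic

namespace Viscoelastic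

/-! Finite front speed means `B > 0`. An unbounded `G` would give `Q(x) → ∞` along the positive
reals and hence `B = 0`, so `G` has a finite supremum `g₀ = G(0+)`. Integration by parts then gives
`Q = g₀ - L(-G')` with `-G'` nonnegative, nonincreasing and integrable. This formula continues `Q`
to the closed half-plane and yields `Re Q > 0` off the origin, `Im p · Im Q ≥ 0` and `Q → g₀`
uniformly in `arg p`; hence `B = √ρ / √g₀`.

The decisive estimate is `Re κ(p) ≥ B Re p` (`IsComplexModulus.mul_re_le_re_waveNumberOf`). It is
obtained from Phragmén-Lindelöf rather than from the spectral measure of `κ`: `exp(-(κ - B p))` has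
exponential type, is bounded by 1 on the imaginary axis because `Re κ ≥ 0`, and by 1 on the positive
axis because `Q ≤ g₀` there. So `|f| ≤ 1 / |Q κ|`, which tends to 0.

The Green integrand is `ρ f(p) exp(-(B|x| - t) p)`. Ahead of the front the rate `B|x| - t` is
positive, and closing the contour on the right (`hasBromwichIntegral_exp_mul_zero`) gives zero. The
condition is open in `|x|`, so the radial derivative vanishes too. -/

/-- A nonnegative, nonincreasing, differentiable and integrable function on `]0, ∞[`. -/
structure DecreasingDensity (h h' : ℝ → ℝ) : Prop where
  nonneg : ∀ t, 0 < t → 0 ≤ h t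
  hasDerivAt : ∀ t, 0 < t → HasDerivAt h (h' t) t
  deriv_nonpos : ∀ t, 0 < t → h' t ≤ 0
  integrableOn : IntegrableOn h (Ioi 0)

/-! ### Laplace transforms of integrable functions on the closed half-plane -/

theorem norm_exp_neg_mul_le_one {p : ℂ} (hp : 0 ≤ p.re) {t : ℝ} (ht : 0 < t) :
    ‖Complex.exp (-(p * (t : ℂ)))‖ ≤ 1 := by
  rw [Complex.norm_exp, Real.exp_le_one_iff]
  simp only [Complex.neg_re, Complex.re_mul_ofReal]
  nlinarith

theorem norm_exp_neg_mul_mul_le {p : ℂ} (hp : 0 ≤ p.re) {t : ℝ} (ht : 0 < t) (a : ℝ) :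
    ‖Complex.exp (-(p * (t : ℂ))) * (a : ℂ)‖ ≤ |a| := by
  rw [norm_mul, Complex.norm_real, Real.norm_eq_abs]
  exact mul_le_of_le_one_left (abs_nonneg _) (norm_exp_neg_mul_le_one hp ht)

theorem aestronglyMeasurable_laplace_integrand {h : ℝ → ℝ} {s : Set ℝ}
    (hh : IntegrableOn h s) (p : ℂ) :
    AEStronglyMeasurable (fun t : ℝ => Complex.exp (-(p * (t : ℂ))) * (h t : ℂ))
      (volume.restrict s) := by
  refine AEStronglyMeasurable.mul ?_ ?_
  · exact (by fun_prop : Continuous fun t : ℝ => Complex.exp (-(p * (t : ℂ)))).aestronglyMeasurable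
  · exact Complex.continuous_ofReal.comp_aestronglyMeasurable hh.aestronglyMeasurable

theorem integrableOn_laplace_integrand {h : ℝ → ℝ} (hh : IntegrableOn h (Ioi 0)) {p : ℂ}
    (hp : 0 ≤ p.re) :
    IntegrableOn (fun t : ℝ => Complex.exp (-(p * (t : ℂ))) * (h t : ℂ)) (Ioi 0) := by
  refine Integrable.mono' hh.norm (aestronglyMeasurable_laplace_integrand hh p) ?_
  exact (ae_restrict_iff' measurableSet_Ioi).2
    (Eventually.of_forall fun t ht => norm_exp_neg_mul_mul_le hp ht (h t))

theorem continuousOn_laplace {h : ℝ → ℝ} (hh : IntegrableOn h (Ioi 0)) :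
    ContinuousOn (laplace h) {p : ℂ | 0 ≤ p.re} := by
  refine continuousOn_of_dominated (bound := fun t => ‖h t‖)
    (fun p _ => aestronglyMeasurable_laplace_integrand hh p) (fun p hp => ?_) hh.norm ?_
  · exact (ae_restrict_iff' measurableSet_Ioi).2
      (Eventually.of_forall fun t ht => norm_exp_neg_mul_mul_le hp ht (h t))
  · exact Eventually.of_forall fun t => by fun_prop

theorem differentiableAt_laplace {h : ℝ → ℝ} (hh : IntegrableOn h (Ioi 0)) {p : ℂ}
    (hp : 0 < p.re) : DifferentiableAt ℂ (laplace h) p := by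
  have hδ : 0 < p.re / 2 := by positivity
  have hs : {z : ℂ | p.re / 2 < z.re} ∈ 𝓝 p :=
    (isOpen_lt continuous_const Complex.continuous_re).mem_nhds (by simpa using hp)
  refine (hasDerivAt_integral_of_dominated_loc_of_deriv_le
    (F := fun (z : ℂ) (t : ℝ) => Complex.exp (-(z * (t : ℂ))) * (h t : ℂ))
    (F' := fun (z : ℂ) (t : ℝ) => Complex.exp (-(z * (t : ℂ))) * (-(t : ℂ)) * (h t : ℂ))
    (bound := fun t => (p.re / 2)⁻¹ * ‖h t‖) hs
    (Eventually.of_forall fun z => aestronglyMeasurable_laplace_integrand hh z)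
    (integrableOn_laplace_integrand hh hp.le) ?_ ?_ (hh.norm.const_mul _) ?_).2.differentiableAt
  · refine AEStronglyMeasurable.mul ?_ ?_
    · exact (by fun_prop : Continuous fun t : ℝ =>
        Complex.exp (-(p * (t : ℂ))) * (-(t : ℂ))).aestronglyMeasurable
    · exact Complex.continuous_ofReal.comp_aestronglyMeasurable hh.aestronglyMeasurable
  · refine (ae_restrict_iff' measurableSet_Ioi).2 (Eventually.of_forall fun t ht z hz => ?_)
    have ht' : 0 < t := ht
    have hz' : p.re / 2 < z.re := hz
    rw [norm_mul, norm_mul, Complex.norm_real, norm_neg, Complex.norm_real, Complex.norm_exp,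
      Real.norm_of_nonneg ht'.le]
    refine mul_le_mul_of_nonneg_right ?_ (norm_nonneg _)
    simp only [Complex.neg_re, Complex.re_mul_ofReal]
    rw [Real.exp_neg, ← one_div, ← one_div, div_mul_eq_mul_div, one_mul,
      div_le_div_iff₀ (Real.exp_pos _) hδ, one_mul]
    -- `t e^{-t Re z} ≤ 1 / Re z ≤ 2 / Re p` comes from `e^s ≥ 1 + s`.
    have := Real.add_one_le_exp (z.re * t)
    nlinarith
  · refine Eventually.of_forall fun t z _ => ?_
    refine HasDerivAt.mul_const ?_ _
    have := ((hasDerivAt_id z).mul_const (t : ℂ)).neg.cexp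
    simpa using this

theorem re_laplace_integrand (p : ℂ) (t a : ℝ) :
    (Complex.exp (-(p * (t : ℂ))) * (a : ℂ)).re =
      Real.exp (-(p.re * t)) * Real.cos (p.im * t) * a := by
  rw [Complex.re_mul_ofReal, Complex.exp_re]
  simp

theorem im_laplace_integrand (p : ℂ) (t a : ℝ) :
    (Complex.exp (-(p * (t : ℂ))) * (a : ℂ)).im =
      -(Real.sin (p.im * t) * (Real.exp (-(p.re * t)) * a)) := by
  rw [Complex.im_mul_ofReal, Complex.exp_im]
  simp
  ring

theorem re_laplace {h : ℝ → ℝ} (hh : IntegrableOn h (Ioi 0)) {p : ℂ} (hp : 0 ≤ p.re) :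
    (laplace h p).re =
      ∫ t in Ioi (0 : ℝ), Real.exp (-(p.re * t)) * Real.cos (p.im * t) * h t := by
  have := integral_re (𝕜 := ℂ) (integrableOn_laplace_integrand hh hp)
  simp only [RCLike.re_eq_complex_re, re_laplace_integrand] at this
  exact this.symm

theorem im_laplace {h : ℝ → ℝ} (hh : IntegrableOn h (Ioi 0)) {p : ℂ} (hp : 0 ≤ p.re) :
    (laplace h p).im =
      ∫ t in Ioi (0 : ℝ), -(Real.sin (p.im * t) * (Real.exp (-(p.re * t)) * h t)) := by
  have := integral_im (𝕜 := ℂ) (integrableOn_laplace_integrand hh hp)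
  simp only [RCLike.im_eq_complex_im, im_laplace_integrand] at this
  exact this.symm

theorem laplace_conj (h : ℝ → ℝ) (p : ℂ) :
    laplace h (starRingEnd ℂ p) = starRingEnd ℂ (laplace h p) := by
  rw [laplace, laplace, ← integral_conj]
  congr 1
  ext t
  simp [← Complex.exp_conj]

theorem exp_mul_cos_lt_one {x y t : ℝ} (hx : 0 ≤ x) (ht : 0 < t) (hy : |y| * t < Real.pi)
    (hxy : x ≠ 0 ∨ y ≠ 0) : Real.exp (-(x * t)) * Real.cos (y * t) < 1 := by
  have h1 := Real.cos_le_one (y * t)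
  have h2 : Real.exp (-(x * t)) ≤ 1 := Real.exp_le_one_iff.2 (by nlinarith)
  have h3 := Real.exp_pos (-(x * t))
  rcases hx.lt_or_eq with hx' | rfl
  · have : Real.exp (-(x * t)) < 1 := by
      rw [← Real.exp_zero]
      exact Real.exp_lt_exp.2 (by nlinarith)
    nlinarith
  · have hy0 : y ≠ 0 := by simpa using hxy
    have hyt : |y * t| < Real.pi := by rwa [abs_mul, abs_of_pos ht]
    rcases h1.lt_or_eq with h1 | h1
    · simpa using h1
    · have hb := abs_lt.1 hyt
      have := (Real.cos_eq_one_iff_of_lt_of_lt (by linarith [Real.pi_pos])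
        (by linarith [Real.pi_pos])).1 h1
      exact absurd this (mul_ne_zero hy0 ht.ne')

/-! ### Sign and decay of the Laplace transform of a decreasing density -/

namespace DecreasingDensity

variable {h h' : ℝ → ℝ}

theorem antitoneOn (H : DecreasingDensity h h') : AntitoneOn h (Ioi 0) := by
  refine antitoneOn_of_deriv_nonpos (convex_Ioi 0)
    (fun t ht => (H.hasDerivAt t ht).continuousAt.continuousWithinAt) ?_ ?_
  · rw [interior_Ioi]
    exact fun t ht => (H.hasDerivAt t ht).differentiableAt.differentiableWithinAt
  · rw [interior_Ioi]
    exact fun t ht => (H.hasDerivAt t ht).deriv ▸ H.deriv_nonpos t ht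

theorem continuousOn (H : DecreasingDensity h h') : ContinuousOn h (Ioi 0) :=
  fun t ht => (H.hasDerivAt t ht).continuousAt.continuousWithinAt

/-- The integrands differ by `h(t) (1 - e^{-xt} cos(yt)) ≥ 0`, which is strictly positive near `t =
0`, where monotonicity keeps `h ≥ h(t₁) > 0`. -/
theorem re_laplace_lt (H : DecreasingDensity h h') {p : ℂ} (hp : 0 ≤ p.re) (hp0 : p ≠ 0)
    {t₁ : ℝ} (ht₁ : 0 < t₁) (hh : h t₁ ≠ 0) : (laplace h p).re < ∫ t in Ioi (0 : ℝ), h t := by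
  have hint : IntegrableOn (fun t => Real.exp (-(p.re * t)) * Real.cos (p.im * t) * h t)
      (Ioi 0) := by
    have := (integrableOn_laplace_integrand H.integrableOn hp).re
    simp only [RCLike.re_eq_complex_re, re_laplace_integrand] at this
    exact this
  rw [re_laplace H.integrableOn hp, ← sub_pos, ← integral_sub H.integrableOn hint,
    setIntegral_pos_iff_support_of_nonneg_ae (f := fun t => h t -
      Real.exp (-(p.re * t)) * Real.cos (p.im * t) * h t) _ (H.integrableOn.sub hint)]
  -- The second bound forces `|y| t < π`; the `+ 1` covers `y = 0`.
  · set τ := min t₁ (Real.pi / (|p.im| + 1)) with hτ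
    have hτ0 : 0 < τ := lt_min ht₁ (by positivity)
    have hsub : Ioo 0 τ ⊆ Function.support (fun t => h t -
        Real.exp (-(p.re * t)) * Real.cos (p.im * t) * h t) ∩ Ioi 0 := by
      rintro t ⟨ht0, ht⟩
      refine ⟨?_, ht0⟩
      have hpos : 0 < h t :=
        ((H.nonneg t₁ ht₁).lt_of_ne' hh).trans_le
          (H.antitoneOn ht0 ht₁ (ht.le.trans (min_le_left _ _)))
      have h1 : t < Real.pi / (|p.im| + 1) := ht.trans_le (min_le_right _ _)
      rw [lt_div_iff₀ (by positivity)] at h1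
      have hne : p.re ≠ 0 ∨ p.im ≠ 0 := by
        by_contra hcon
        push Not at hcon
        exact hp0 (Complex.ext hcon.1 hcon.2)
      have := exp_mul_cos_lt_one (y := p.im) hp ht0 (by nlinarith) hne
      have : 0 < h t - Real.exp (-(p.re * t)) * Real.cos (p.im * t) * h t := by nlinarith
      exact this.ne'
    refine lt_of_lt_of_le ?_ (measure_mono hsub)
    simpa using hτ0
  · refine (ae_restrict_iff' measurableSet_Ioi).2 (Eventually.of_forall fun t ht => ?_)
    have ht' : 0 < t := ht
    have h0 := H.nonneg t ht
    have h1 := Real.cos_le_one (p.im * t)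
    have h2 : Real.exp (-(p.re * t)) ≤ 1 := Real.exp_le_one_iff.2 (by nlinarith)
    have h3 := Real.exp_pos (-(p.re * t))
    have : Real.exp (-(p.re * t)) * Real.cos (p.im * t) ≤ 1 := by nlinarith
    simp only [Pi.zero_apply]
    nlinarith

theorem mul_le_integral (H : DecreasingDensity h h') {a : ℝ} (ha : 0 < a) :
    a * h a ≤ ∫ t in Ioi (0 : ℝ), h t := by
  have h1 : ∫ _t in Ioc 0 a, h a ≤ ∫ t in Ioc 0 a, h t := by
    refine setIntegral_mono_on (by simp) (H.integrableOn.mono_set Ioc_subset_Ioi_self)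
      measurableSet_Ioc fun t ht => H.antitoneOn ht.1 ha ht.2
  have h2 : ∫ t in Ioc 0 a, h t ≤ ∫ t in Ioi 0, h t :=
    setIntegral_mono_set H.integrableOn
      ((ae_restrict_iff' measurableSet_Ioi).2 (Eventually.of_forall H.nonneg))
      (Eventually.of_forall fun t (ht : t ∈ Ioc 0 a) => ht.1)
  rw [setIntegral_const] at h1
  simp [ha.le] at h1
  linarith

/-- The primitive `(1 - cos(yt)) / y` of the sine is nonnegative, so multiplying it by `h` and
differentiating gives at most `sin(yt) h`, because `h' ≤ 0`. The boundary term at `b` has a good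
sign; the one at `a` is at most `(y/2) a² h(a)`, and `a h(a) ≤ ∫ h`. The one-sided form of the
fundamental theorem avoids any integrability of `h'`. -/
theorem neg_le_integral_sin_mul (H : DecreasingDensity h h') {y a b : ℝ} (hy : 0 < y)
    (ha : 0 < a) (hab : a ≤ b) :
    -(a * y / 2 * ∫ t in Ioi (0 : ℝ), h t) ≤ ∫ t in a..b, Real.sin (y * t) * h t := by
  have hIcc : Icc a b ⊆ Ioi 0 := fun t ht => ha.trans_le ht.1
  have hb : 0 < b := ha.trans_le hab
  have key := intervalIntegral.sub_le_integral_of_hasDeriv_right_of_le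
    (g := fun t => (1 - Real.cos (y * t)) / y * h t)
    (g' := fun t => Real.sin (y * t) * h t + (1 - Real.cos (y * t)) / y * h' t)
    (φ := fun t => Real.sin (y * t) * h t) hab ?_ ?_ ?_ ?_
  · have h1 : 0 ≤ (1 - Real.cos (y * b)) / y * h b :=
      mul_nonneg (div_nonneg (by linarith [Real.cos_le_one (y * b)]) hy.le) (H.nonneg b hb)
    have h2 := H.mul_le_integral ha
    have h3 := Real.one_sub_sq_div_two_le_cos (x := y * a)
    have h4 : (1 - Real.cos (y * a)) / y * h a ≤ a * y / 2 * (a * h a) := by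
      have : (1 - Real.cos (y * a)) / y ≤ a * y / 2 * a := by
        rw [div_le_iff₀ hy]; nlinarith
      calc _ ≤ a * y / 2 * a * h a := mul_le_mul_of_nonneg_right this (H.nonneg a ha)
        _ = _ := by ring
    have h5 : a * y / 2 * (a * h a) ≤ a * y / 2 * ∫ t in Ioi (0 : ℝ), h t :=
      mul_le_mul_of_nonneg_left h2 (by positivity)
    linarith
  · exact ContinuousOn.mul (by fun_prop) (H.continuousOn.mono hIcc)
  · intro t ht
    have ht0 : 0 < t := ha.trans ht.1
    have h1 : HasDerivAt (fun t => (1 - Real.cos (y * t)) / y) (Real.sin (y * t)) t := by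
      refine ((((hasDerivAt_id' t).const_mul y).cos.const_sub 1).div_const y).congr_deriv ?_
      field_simp
    exact (h1.mul (H.hasDerivAt t ht0)).hasDerivWithinAt
  · exact (ContinuousOn.mul (by fun_prop) (H.continuousOn.mono hIcc)).integrableOn_Icc
  · intro t ht
    have ht0 : 0 < t := ha.trans ht.1
    have : (1 - Real.cos (y * t)) / y * h' t ≤ 0 :=
      mul_nonpos_of_nonneg_of_nonpos
        (div_nonneg (by linarith [Real.cos_le_one (y * t)]) hy.le) (H.deriv_nonpos t ht0)
    linarith

/-- Let `b → ∞`, then `a → 0+`. The cutoff `a` is needed because `h` may blow up at 0, and its error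
`(a y / 2) ∫ h` vanishes. -/
theorem integral_sin_mul_nonneg (H : DecreasingDensity h h') {y : ℝ} (hy : 0 < y) :
    0 ≤ ∫ t in Ioi (0 : ℝ), Real.sin (y * t) * h t := by
  have hint : IntegrableOn (fun t => Real.sin (y * t) * h t) (Ioi 0) := by
    refine H.integrableOn.bdd_mul (c := 1) (Continuous.aestronglyMeasurable (by fun_prop)) ?_
    exact Eventually.of_forall fun t => Real.abs_sin_le_one _
  have h1 : ∀ a : ℝ, 0 < a →
      -(a * y / 2 * ∫ t in Ioi (0 : ℝ), h t) ≤ ∫ t in Ioi a, Real.sin (y * t) * h t := by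
    intro a ha
    refine ge_of_tendsto (intervalIntegral_tendsto_integral_Ioi a
      (hint.mono_set (Ioi_subset_Ioi ha.le)) tendsto_id) ?_
    filter_upwards [eventually_ge_atTop a] with b hb
    exact H.neg_le_integral_sin_mul hy ha hb
  have h2 : Tendsto (fun a : ℝ => -(a * y / 2 * ∫ t in Ioi (0 : ℝ), h t)) (𝓝[>] 0) (𝓝 0) := by
    have : Continuous (fun a : ℝ => -(a * y / 2 * ∫ t in Ioi (0 : ℝ), h t)) := by fun_prop
    simpa using (this.tendsto 0).mono_left nhdsWithin_le_nhds
  have h3 : Tendsto (fun a : ℝ => ∫ t in Ioi a, Real.sin (y * t) * h t) (𝓝[>] 0)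
      (𝓝 (∫ t in Ioi (0 : ℝ), Real.sin (y * t) * h t)) := by
    -- Extending by zero gives an integrable function on the line, whose primitive is continuous at
    -- 0.
    have hind : Integrable (indicator (Ioi 0) fun t => Real.sin (y * t) * h t) :=
      hint.integrable_indicator measurableSet_Ioi
    have hc := (hind.continuous_primitive 0).tendsto 0
    have hs : Tendsto (fun a : ℝ => (∫ t in Ioi (0 : ℝ), Real.sin (y * t) * h t) -
        ∫ t in (0 : ℝ)..a, indicator (Ioi 0) (fun t => Real.sin (y * t) * h t) t) (𝓝[>] 0)
        (𝓝 (∫ t in Ioi (0 : ℝ), Real.sin (y * t) * h t)) := by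
      simpa using (hc.mono_left nhdsWithin_le_nhds).const_sub
        (∫ t in Ioi (0 : ℝ), Real.sin (y * t) * h t)
    refine hs.congr' ?_
    filter_upwards [self_mem_nhdsWithin] with a ha
    have ha' : 0 < a := ha
    rw [intervalIntegral.integral_of_le ha'.le, setIntegral_indicator measurableSet_Ioi,
      inter_eq_left.2 Ioc_subset_Ioi_self, ← Ioc_union_Ioi_eq_Ioi ha'.le,
      setIntegral_union (by rw [Set.disjoint_left]; intro x hx hx'; exact absurd hx.2 (not_le.2 hx'))
        measurableSet_Ioi (hint.mono_set Ioc_subset_Ioi_self)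
        (hint.mono_set (Ioi_subset_Ioi ha'.le))]
    ring
  refine le_of_tendsto_of_tendsto h2 h3 ?_
  filter_upwards [self_mem_nhdsWithin] with a ha using h1 a ha

/-- Absorbing `e^{-xt}` into the density reduces the imaginary part at `x + iy` to a pure sine
integral. -/
theorem mul_exp (H : DecreasingDensity h h') {x : ℝ} (hx : 0 ≤ x) :
    DecreasingDensity (fun t => Real.exp (-(x * t)) * h t)
      (fun t => -x * Real.exp (-(x * t)) * h t + Real.exp (-(x * t)) * h' t) where
  nonneg t ht := mul_nonneg (Real.exp_pos _).le (H.nonneg t ht)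
  hasDerivAt t ht := by
    have h1 : HasDerivAt (fun t : ℝ => Real.exp (-(x * t))) (-x * Real.exp (-(x * t))) t := by
      refine (((hasDerivAt_id' t).const_mul x).fun_neg.exp).congr_deriv ?_
      ring
    exact h1.mul (H.hasDerivAt t ht)
  deriv_nonpos t ht := by
    have h1 := Real.exp_pos (-(x * t))
    have h2 := H.nonneg t ht
    have h3 := H.deriv_nonpos t ht
    have h4 : 0 ≤ x * (Real.exp (-(x * t)) * h t) := by positivity
    nlinarith
  integrableOn := by
    refine Integrable.mono' H.integrableOn.norm
      ((Continuous.aestronglyMeasurable (by fun_prop)).mul H.integrableOn.aestronglyMeasurable) ?_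
    refine (ae_restrict_iff' measurableSet_Ioi).2 (Eventually.of_forall fun t ht => ?_)
    have ht' : 0 < t := ht
    rw [norm_mul, Real.norm_eq_abs, Real.abs_exp]
    exact mul_le_of_le_one_left (norm_nonneg _) (Real.exp_le_one_iff.2 (by nlinarith))

theorem im_laplace_nonpos (H : DecreasingDensity h h') {p : ℂ} (hp : 0 ≤ p.re)
    (hp' : 0 < p.im) : (laplace h p).im ≤ 0 := by
  rw [im_laplace H.integrableOn hp, integral_neg]
  exact neg_nonpos.2 ((H.mul_exp hp).integral_sin_mul_nonneg hp')

theorem im_mul_im_laplace_nonpos (H : DecreasingDensity h h') {p : ℂ} (hp : 0 ≤ p.re) :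
    p.im * (laplace h p).im ≤ 0 := by
  rcases lt_trichotomy p.im 0 with hi | hi | hi
  · have := H.im_laplace_nonpos (p := starRingEnd ℂ p) (by simpa using hp) (by simpa using hi)
    rw [laplace_conj, Complex.conj_im] at this
    nlinarith
  · simp [hi]
  · exact mul_nonpos_of_nonneg_of_nonpos hi.le (H.im_laplace_nonpos hp hi)

/-- Integration by parts: the boundary terms and the total variation `h(a) - h(b)` add up to `2 h(a)
/ |p|`, uniformly in `b` and `arg p`; the constant 3 leaves slack. -/
theorem norm_integral_exp_le (H : DecreasingDensity h h')
    (hc : ContinuousOn h' (Ioi 0)) {p : ℂ} (hp : 0 ≤ p.re) (hp0 : p ≠ 0) {a b : ℝ}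
    (ha : 0 < a) (hab : a ≤ b) :
    ‖∫ t in a..b, Complex.exp (-(p * (t : ℂ))) * (h t : ℂ)‖ ≤ 3 * h a / ‖p‖ := by
  have hIcc : uIcc a b ⊆ Ioi 0 := by
    rw [uIcc_of_le hab]; exact fun t ht => ha.trans_le ht.1
  have hb : 0 < b := ha.trans_le hab
  have hv : ∀ t ∈ uIcc a b, HasDerivAt (fun t : ℝ => (h t : ℂ)) ((h' t : ℝ) : ℂ) t :=
    fun t ht => (H.hasDerivAt t (hIcc ht)).ofReal_comp
  have hu : ∀ t ∈ uIcc a b, HasDerivAt (fun t : ℝ => -Complex.exp (-(p * (t : ℂ))) / p)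
      (Complex.exp (-(p * (t : ℂ)))) t := by
    intro t _
    refine (((((hasDerivAt_id' t).ofReal_comp).const_mul p).fun_neg.cexp.fun_neg).div_const
      p).congr_deriv ?_
    field_simp
    simp
  have hci : IntervalIntegrable (fun t => ((h' t : ℝ) : ℂ)) volume a b :=
    (Complex.continuous_ofReal.comp_continuousOn (hc.mono hIcc)).intervalIntegrable
  have hparts := intervalIntegral.integral_mul_deriv_eq_deriv_mul hv hu hci
    (Continuous.intervalIntegrable (by fun_prop) _ _)
  have hI : ∫ t in a..b, Complex.exp (-(p * (t : ℂ))) * (h t : ℂ) =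
      ∫ t in a..b, (h t : ℂ) * Complex.exp (-(p * (t : ℂ))) := by
    congr 1; ext t; ring
  have hu1 : ∀ t : ℝ, 0 < t → ‖-Complex.exp (-(p * (t : ℂ))) / p‖ ≤ 1 / ‖p‖ := by
    intro t ht
    rw [norm_div, norm_neg]
    exact div_le_div_of_nonneg_right (norm_exp_neg_mul_le_one hp ht) (norm_nonneg _)
  have hterm : ∀ t : ℝ, 0 < t → ‖(h t : ℂ) * (-Complex.exp (-(p * (t : ℂ))) / p)‖ ≤
      h t * (1 / ‖p‖) := by
    intro t ht
    rw [norm_mul, Complex.norm_real, Real.norm_of_nonneg (H.nonneg t ht)]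
    exact mul_le_mul_of_nonneg_left (hu1 t ht) (H.nonneg t ht)
  have hlast : ‖∫ t in a..b, ((h' t : ℝ) : ℂ) * (-Complex.exp (-(p * (t : ℂ))) / p)‖ ≤
      (h a - h b) * (1 / ‖p‖) := by
    have hbound := intervalIntegral.norm_integral_le_of_norm_le hab
      (μ := volume) (f := fun t => ((h' t : ℝ) : ℂ) * (-Complex.exp (-(p * (t : ℂ))) / p))
      (g := fun t => -h' t * (1 / ‖p‖)) ?_ ?_
    · refine hbound.trans (le_of_eq ?_)
      rw [intervalIntegral.integral_mul_const, intervalIntegral.integral_neg,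
        intervalIntegral.integral_eq_sub_of_hasDerivAt (f := h)
          (fun t ht => H.hasDerivAt t (hIcc ht)) (hc.mono hIcc).intervalIntegrable]
      ring
    · refine Eventually.of_forall fun t ht => ?_
      have ht0 : 0 < t := ha.trans ht.1
      rw [norm_mul, Complex.norm_real, Real.norm_of_nonpos (H.deriv_nonpos t ht0)]
      exact mul_le_mul_of_nonneg_left (hu1 t ht0) (neg_nonneg.2 (H.deriv_nonpos t ht0))
    · exact ((hc.mono hIcc).intervalIntegrable.neg).mul_const _
  have hmono : h b ≤ h a := H.antitoneOn ha hb hab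
  have hb0 := H.nonneg b hb
  have hp1 : 0 < 1 / ‖p‖ := by have := norm_pos_iff.2 hp0; positivity
  rw [hI, hparts]
  calc _ ≤ h b * (1 / ‖p‖) + h a * (1 / ‖p‖) + (h a - h b) * (1 / ‖p‖) :=
        (norm_sub_le _ _).trans (add_le_add ((norm_sub_le _ _).trans
          (add_le_add (hterm b hb) (hterm a ha))) hlast)
    _ ≤ 3 * h a / ‖p‖ := by
        rw [mul_div_assoc, div_eq_mul_one_div (h a)]
        nlinarith [H.nonneg a ha]

/-- A Riemann-Lebesgue lemma uniform in `arg p`: the mass on `]0, a]` is small by integrability, and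
the rest is `O(h(a) / |p|)`. -/
theorem norm_laplace_lt (H : DecreasingDensity h h') (hc : ContinuousOn h' (Ioi 0)) {δ : ℝ}
    (hδ : 0 < δ) : ∃ R : ℝ, 0 < R ∧ ∀ p : ℂ, 0 ≤ p.re → R ≤ ‖p‖ → ‖laplace h p‖ < δ := by
  have hind : Integrable (indicator (Ioi 0) h) := H.integrableOn.integrable_indicator
    measurableSet_Ioi
  have hcont : Tendsto (fun a : ℝ => ∫ t in (0 : ℝ)..a, indicator (Ioi 0) h t) (𝓝[>] 0) (𝓝 0) := by
    have := ((hind.continuous_primitive 0).tendsto 0).mono_left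
      (nhdsWithin_le_nhds (s := Ioi 0))
    simpa using this
  obtain ⟨a, haδ, ha⟩ := ((hcont.eventually (gt_mem_nhds (half_pos hδ))).and
    (self_mem_nhdsWithin (s := Ioi 0))).exists
  have ha' : 0 < a := ha
  rw [intervalIntegral.integral_of_le ha'.le, setIntegral_indicator measurableSet_Ioi,
    inter_eq_left.2 Ioc_subset_Ioi_self] at haδ
  -- `6 h(a) / δ` brings the tail below `δ / 2`; the `+ 1` keeps the radius positive when `h(a) =
  -- 0`.
  refine ⟨6 * h a / δ + 1, by have := H.nonneg a ha; positivity, fun p hp hR => ?_⟩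
  have ha0 := H.nonneg a ha
  have hp1 : 0 < ‖p‖ := lt_of_lt_of_le (by positivity) hR
  have hint := integrableOn_laplace_integrand H.integrableOn hp
  have hsplit : laplace h p = (∫ t in Ioc 0 a, Complex.exp (-(p * (t : ℂ))) * (h t : ℂ)) +
      ∫ t in Ioi a, Complex.exp (-(p * (t : ℂ))) * (h t : ℂ) := by
    rw [laplace, ← Ioc_union_Ioi_eq_Ioi ha'.le,
      setIntegral_union (by rw [Set.disjoint_left]; intro x hx hx'; exact absurd hx.2 (not_le.2 hx'))
        measurableSet_Ioi (hint.mono_set Ioc_subset_Ioi_self)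
        (hint.mono_set (Ioi_subset_Ioi ha'.le))]
  have h1 : ‖∫ t in Ioc 0 a, Complex.exp (-(p * (t : ℂ))) * (h t : ℂ)‖ < δ / 2 := by
    refine lt_of_le_of_lt (norm_integral_le_of_norm_le
      (H.integrableOn.mono_set Ioc_subset_Ioi_self) ?_) haδ
    refine (ae_restrict_iff' measurableSet_Ioc).2 (Eventually.of_forall fun t ht => ?_)
    have := norm_exp_neg_mul_mul_le hp ht.1 (h t)
    rwa [abs_of_nonneg (H.nonneg t ht.1)] at this
  have h2 : ‖∫ t in Ioi a, Complex.exp (-(p * (t : ℂ))) * (h t : ℂ)‖ ≤ 3 * h a / ‖p‖ := by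
    refine le_of_tendsto (intervalIntegral_tendsto_integral_Ioi a
      (hint.mono_set (Ioi_subset_Ioi ha'.le)) tendsto_id).norm ?_
    filter_upwards [eventually_ge_atTop a] with b hb
    exact H.norm_integral_exp_le hc hp (norm_pos_iff.1 hp1) ha hb
  have h3 : 3 * h a / ‖p‖ < δ / 2 := by
    rw [div_lt_iff₀ hp1]
    have h4 : 6 * h a / δ < ‖p‖ := by linarith
    rw [div_lt_iff₀ hδ] at h4
    linarith
  rw [hsplit]
  linarith [norm_add_le (∫ t in Ioc 0 a, Complex.exp (-(p * (t : ℂ))) * (h t : ℂ))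
    (∫ t in Ioi a, Complex.exp (-(p * (t : ℂ))) * (h t : ℂ))]

end DecreasingDensity

/-! ### Elementary properties of completely monotonic moduli -/

namespace LICM

variable {G : ℝ → ℝ}

theorem nonneg (hG : LICM G) {t : ℝ} (ht : 0 < t) : 0 ≤ G t := by
  simpa using hG.1.2 0 t ht

theorem hasDerivAt (hG : LICM G) {t : ℝ} (ht : 0 < t) : HasDerivAt G (deriv G t) t :=
  ((hG.1.1.differentiableOn (by simp)).differentiableAt (Ioi_mem_nhds ht)).hasDerivAt

theorem contDiffOn_deriv (hG : LICM G) :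
    ContDiffOn ℝ ((⊤ : ℕ∞) : WithTop ℕ∞) (deriv G) (Ioi 0) :=
  hG.1.1.deriv_of_isOpen isOpen_Ioi (by simp)

theorem hasDerivAt_deriv (hG : LICM G) {t : ℝ} (ht : 0 < t) :
    HasDerivAt (deriv G) (deriv (deriv G) t) t :=
  ((hG.contDiffOn_deriv.differentiableOn (by simp)).differentiableAt
    (Ioi_mem_nhds ht)).hasDerivAt

theorem continuousOn_deriv_deriv (hG : LICM G) : ContinuousOn (deriv (deriv G)) (Ioi 0) :=
  (hG.contDiffOn_deriv.deriv_of_isOpen (m := ((⊤ : ℕ∞) : WithTop ℕ∞)) isOpen_Ioi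
    (by simp)).continuousOn

theorem deriv_nonpos (hG : LICM G) {t : ℝ} (ht : 0 < t) : deriv G t ≤ 0 := by
  simpa using hG.1.2 1 t ht

theorem deriv_deriv_nonneg (hG : LICM G) {t : ℝ} (ht : 0 < t) : 0 ≤ deriv (deriv G) t := by
  simpa [iteratedDeriv_succ] using hG.1.2 2 t ht

theorem antitoneOn (hG : LICM G) : AntitoneOn G (Ioi 0) := by
  refine antitoneOn_of_deriv_nonpos (convex_Ioi 0)
    (fun t ht => (hG.hasDerivAt ht).continuousAt.continuousWithinAt) ?_ ?_
  · rw [interior_Ioi]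
    exact fun t ht => (hG.hasDerivAt ht).differentiableAt.differentiableWithinAt
  · rw [interior_Ioi]
    exact fun t ht => hG.deriv_nonpos ht

theorem continuousOn (hG : LICM G) : ContinuousOn G (Ioi 0) := hG.1.1.continuousOn

/-- Local integrability handles `]0, 1]`; beyond 1 monotonicity gives `G ≤ G(1)`. -/
theorem integrableOn_exp_mul (hG : LICM G) {x : ℝ} (hx : 0 < x) :
    IntegrableOn (fun t => Real.exp (-(x * t)) * G t) (Ioi 0) := by
  have hmeas : AEStronglyMeasurable (fun t => Real.exp (-(x * t)) * G t)
      (volume.restrict (Ioi 0)) :=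
    (ContinuousOn.mul (by fun_prop) hG.continuousOn).aestronglyMeasurable measurableSet_Ioi
  rw [← Ioc_union_Ioi_eq_Ioi zero_le_one, integrableOn_union]
  constructor
  · have h1 : IntegrableOn G (Icc 0 1) :=
      hG.2.integrableOn_compact_subset Icc_subset_Ici_self isCompact_Icc
    refine Integrable.mono' (h1.mono_set Ioc_subset_Icc_self).norm
      (hmeas.mono_measure (Measure.restrict_mono Ioc_subset_Ioi_self le_rfl)) ?_
    refine (ae_restrict_iff' measurableSet_Ioc).2 (Eventually.of_forall fun t ht => ?_)
    rw [norm_mul, Real.norm_eq_abs, Real.abs_exp]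
    exact mul_le_of_le_one_left (norm_nonneg _)
      (Real.exp_le_one_iff.2 (by have := ht.1; nlinarith))
  · have h2 : IntegrableOn (fun t => Real.exp (-x * t) * G 1) (Ioi 1) :=
      (exp_neg_integrableOn_Ioi 1 hx).mul_const _
    refine Integrable.mono' h2
      (hmeas.mono_measure (Measure.restrict_mono (Ioi_subset_Ioi zero_le_one) le_rfl)) ?_
    refine (ae_restrict_iff' measurableSet_Ioi).2 (Eventually.of_forall fun t ht => ?_)
    have ht1 : (1 : ℝ) < t := ht
    have ht0 : 0 < t := by linarith
    rw [norm_mul, Real.norm_eq_abs, Real.abs_exp, Real.norm_of_nonneg (hG.nonneg ht0), neg_mul]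
    exact mul_le_mul_of_nonneg_left (hG.antitoneOn (mem_Ioi.2 one_pos) ht0 ht1.le) (Real.exp_pos _).le

end LICM

/-! ### The modulus on the positive axis and the coefficient `B` -/

theorem modulusQ_ofReal (G : ℝ → ℝ) (x : ℝ) :
    modulusQ G (x : ℂ) = ((x * ∫ t in Ioi (0 : ℝ), Real.exp (-(x * t)) * G t : ℝ) : ℂ) := by
  rw [modulusQ, laplace, Complex.ofReal_mul, ← integral_complex_ofReal]
  congr 2
  ext t
  push_cast
  ring

theorem waveNumber_re_div_of_modulusQ_eq {ρ : ℝ} {G : ℝ → ℝ} {x q : ℝ} (hx : 0 < x)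
    (hq : 0 ≤ q) (h : modulusQ G (x : ℂ) = (q : ℂ)) :
    (waveNumber ρ G (x : ℂ)).re / x = Real.sqrt ρ / Real.sqrt q := by
  rw [waveNumber, h, Complex.sqrt_of_nonneg (by exact_mod_cast hq)]
  have : (Real.sqrt ρ : ℂ) * x / ((Real.sqrt (q : ℂ).re : ℝ) : ℂ) =
      ((Real.sqrt ρ * x / Real.sqrt q : ℝ) : ℂ) := by
    push_cast
    rfl
  rw [this, Complex.ofReal_re]
  field_simp

theorem linearCoeff_eq_of_tendsto {ρ : ℝ} {G : ℝ → ℝ} {g : ℝ → ℝ} {B : ℝ}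
    (h0 : ∀ x, 0 < x → 0 ≤ g x) (hg : ∀ x : ℝ, 0 < x → modulusQ G (x : ℂ) = (g x : ℂ))
    (hB : Tendsto (fun x => Real.sqrt ρ / Real.sqrt (g x)) atTop (𝓝 B)) :
    linearCoeff ρ G = B := by
  refine Tendsto.limUnder_eq (hB.congr' ?_)
  filter_upwards [eventually_gt_atTop 0] with x hx
  exact (waveNumber_re_div_of_modulusQ_eq hx (h0 x hx) (hg x hx)).symm

namespace LICM

variable {G : ℝ → ℝ}

theorem mul_integral_nonneg (hG : LICM G) {x : ℝ} (hx : 0 < x) :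
    0 ≤ x * ∫ t in Ioi (0 : ℝ), Real.exp (-(x * t)) * G t :=
  mul_nonneg hx.le (setIntegral_nonneg measurableSet_Ioi fun _ ht =>
    mul_nonneg (Real.exp_pos _).le (hG.nonneg ht))

/-- On `]0, 1/x]`, an interval of length `1/x`, the exponential is at least `e^{-1}` and `G ≥
G(t₀)`. Large values of `G` near 0 thus force `Q(x)` to be large. -/
theorem exp_neg_one_mul_le (hG : LICM G) {t₀ x : ℝ} (ht₀ : 0 < t₀) (hx : 1 / t₀ ≤ x) :
    Real.exp (-1) * G t₀ ≤ x * ∫ t in Ioi (0 : ℝ), Real.exp (-(x * t)) * G t := by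
  have hx0 : 0 < x := lt_of_lt_of_le (by positivity) hx
  have hxt : 1 / x ≤ t₀ := by rw [div_le_iff₀ ht₀] at hx; rw [div_le_iff₀ hx0]; linarith
  have hint := hG.integrableOn_exp_mul hx0
  have h1 : ∫ _t in Ioc 0 (1 / x), Real.exp (-1) * G t₀ ≤
      ∫ t in Ioc 0 (1 / x), Real.exp (-(x * t)) * G t := by
    refine setIntegral_mono_on (integrableOn_const (by simp)) (hint.mono_set Ioc_subset_Ioi_self)
      measurableSet_Ioc fun t ht => ?_
    have h2 : x * t ≤ 1 := by
      have := ht.2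
      rw [le_div_iff₀ hx0] at this
      linarith
    exact mul_le_mul (Real.exp_le_exp.2 (by linarith))
      (hG.antitoneOn ht.1 ht₀ (ht.2.trans hxt)) (hG.nonneg ht₀) (Real.exp_pos _).le
  have h2 : ∫ t in Ioc 0 (1 / x), Real.exp (-(x * t)) * G t ≤
      ∫ t in Ioi 0, Real.exp (-(x * t)) * G t :=
    setIntegral_mono_set hint
      ((ae_restrict_iff' measurableSet_Ioi).2
        (Eventually.of_forall fun t ht => mul_nonneg (Real.exp_pos _).le (hG.nonneg ht)))
      (Eventually.of_forall fun t (ht : t ∈ Ioc 0 (1 / x)) => ht.1)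
  rw [setIntegral_const] at h1
  simp only [Measure.real, Real.volume_Ioc, sub_zero, smul_eq_mul] at h1
  rw [ENNReal.toReal_ofReal (by positivity)] at h1
  have h3 := mul_le_mul_of_nonneg_left (h1.trans h2) hx0.le
  rwa [← mul_assoc, mul_one_div_cancel hx0.ne', one_mul] at h3

/-- The wavefront speed is infinite if the relaxation modulus is unbounded at `0`. -/
theorem bddAbove_of_linearCoeff_ne_zero (hG : LICM G) {ρ : ℝ} (hB : linearCoeff ρ G ≠ 0) :
    BddAbove (G '' Ioi 0) := by
  by_contra hcon
  refine hB (linearCoeff_eq_of_tendsto (fun x hx => hG.mul_integral_nonneg hx)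
    (fun x _ => modulusQ_ofReal G x) ?_)
  refine Tendsto.div_atTop tendsto_const_nhds (Real.tendsto_sqrt_atTop.comp ?_)
  refine tendsto_atTop.2 fun M => ?_
  rw [not_bddAbove_iff] at hcon
  obtain ⟨_, ⟨t₀, ht₀, rfl⟩, hM⟩ := hcon (M / Real.exp (-1))
  filter_upwards [eventually_ge_atTop (1 / t₀)] with x hx
  refine le_trans ?_ (hG.exp_neg_one_mul_le ht₀ hx)
  rw [div_lt_iff₀ (Real.exp_pos _)] at hM
  linarith

/-! ### Bounded moduli: integrability of `G'` and the formula for `Q` -/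

theorem exists_tendsto_atTop (hG : LICM G) : ∃ L, 0 ≤ L ∧ Tendsto G atTop (𝓝 L) := by
  have hanti : Antitone fun t : ℝ => G (max t 1) := fun s t hst =>
    hG.antitoneOn (mem_Ioi.2 (lt_max_of_lt_right one_pos))
      (mem_Ioi.2 (lt_max_of_lt_right one_pos))
      (max_le_max_right 1 hst)
  have hpos : ∀ t : ℝ, 0 ≤ G (max t 1) := fun t => hG.nonneg (lt_max_of_lt_right one_pos)
  rcases tendsto_atTop_of_antitone hanti with h | ⟨L, hL⟩
  · obtain ⟨t, ht⟩ := (h.eventually (eventually_lt_atBot 0)).exists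
    exact absurd ht (not_lt.2 (hpos t))
  · refine ⟨L, ge_of_tendsto' hL hpos, hL.congr' ?_⟩
    filter_upwards [eventually_ge_atTop 1] with t ht
    rw [max_eq_left ht]

theorem tendsto_nhdsGT (hG : LICM G) (hb : BddAbove (G '' Ioi 0)) :
    Tendsto G (𝓝[>] 0) (𝓝 (sSup (G '' Ioi 0))) :=
  hG.antitoneOn.tendsto_nhdsGT hb

theorem le_sSup (hb : BddAbove (G '' Ioi 0)) {t : ℝ} (ht : 0 < t) :
    G t ≤ sSup (G '' Ioi 0) := le_csSup hb ⟨t, ht, rfl⟩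

theorem integrableOn_deriv_and_integral (hG : LICM G) (hb : BddAbove (G '' Ioi 0)) :
    IntegrableOn (deriv G) (Ioi 0) ∧ -∫ t in Ioi 0, deriv G t ≤ sSup (G '' Ioi 0) := by
  obtain ⟨L, hL0, hL⟩ := hG.exists_tendsto_atTop
  set G₀ := sSup (G '' Ioi 0)
  -- `G 0` is arbitrary; resetting it to the supremum makes `G` right-continuous at 0, as the
  -- fundamental theorem on `]0, ∞[` requires.
  have hev : ∀ t : ℝ, 0 < t → Function.update G 0 G₀ =ᶠ[𝓝 t] G := fun t ht => by
    filter_upwards [Ioi_mem_nhds ht] with s hs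
    exact Function.update_of_ne (ne_of_gt hs) _ _
  have hc : ContinuousWithinAt (Function.update G 0 G₀) (Ici 0) 0 := by
    rw [continuousWithinAt_update_same, Ici_sdiff_left]
    exact hG.tendsto_nhdsGT hb
  have hd : ∀ t ∈ Ioi (0 : ℝ), HasDerivAt (Function.update G 0 G₀) (deriv G t) t :=
    fun t ht => (hG.hasDerivAt ht).congr_of_eventuallyEq (hev t ht)
  have hn : ∀ t ∈ Ioi (0 : ℝ), deriv G t ≤ 0 := fun t ht => hG.deriv_nonpos ht
  have hl : Tendsto (Function.update G 0 G₀) atTop (𝓝 L) := by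
    refine hL.congr' ?_
    filter_upwards [eventually_gt_atTop 0] with t ht
    exact (Function.update_of_ne ht.ne' _ _).symm
  refine ⟨integrableOn_Ioi_deriv_of_nonpos hc hd hn hl, ?_⟩
  rw [integral_Ioi_of_hasDerivAt_of_nonpos hc hd hn hl, Function.update_self]
  linarith

theorem decreasingDensity (hG : LICM G) (hb : BddAbove (G '' Ioi 0)) :
    DecreasingDensity (fun t => -deriv G t) (fun t => -deriv (deriv G) t) where
  nonneg _ ht := neg_nonneg.2 (hG.deriv_nonpos ht)
  hasDerivAt _ ht := (hG.hasDerivAt_deriv ht).neg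
  deriv_nonpos _ ht := neg_nonpos.2 (hG.deriv_deriv_nonneg ht)
  integrableOn := (hG.integrableOn_deriv_and_integral hb).1.neg

/-- Integration by parts: the boundary value at 0 is `G(0+)`, and the one at infinity vanishes since
`Re p > 0` and `G` is bounded. -/
theorem modulusQ_eq (hG : LICM G) (hb : BddAbove (G '' Ioi 0)) {p : ℂ} (hp : 0 < p.re) :
    modulusQ G p = (sSup (G '' Ioi 0) : ℝ) - laplace (fun t => -deriv G t) p := by
  set G₀ := sSup (G '' Ioi 0) with hG₀
  have hnorm : ∀ t : ℝ, 0 < t → ‖Complex.exp (-(p * (t : ℂ))) * (G t : ℂ)‖ =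
      Real.exp (-(p.re * t)) * G t := by
    intro t ht
    rw [norm_mul, Complex.norm_real, Real.norm_of_nonneg (hG.nonneg ht), Complex.norm_exp]
    simp
  have hle : ∀ t : ℝ, 0 < t → ‖Complex.exp (-(p * (t : ℂ))) * (G t : ℂ)‖ ≤
      Real.exp (-p.re * t) * G₀ := by
    intro t ht
    rw [hnorm t ht, neg_mul]
    exact mul_le_mul_of_nonneg_left (le_sSup hb ht) (Real.exp_pos _).le
  have hI : IntegrableOn (fun t : ℝ => Complex.exp (-(p * (t : ℂ))) * (G t : ℂ)) (Ioi 0) := by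
    refine Integrable.mono' (hG.integrableOn_exp_mul hp) ?_ ?_
    · refine ContinuousOn.aestronglyMeasurable ?_ measurableSet_Ioi
      exact ContinuousOn.mul (by fun_prop)
        (Complex.continuous_ofReal.comp_continuousOn hG.continuousOn)
    · exact (ae_restrict_iff' measurableSet_Ioi).2
        (Eventually.of_forall fun t ht => (hnorm t ht).le)
  have hu : ∀ t ∈ Ioi (0 : ℝ), HasDerivAt (fun t : ℝ => Complex.exp (-(p * (t : ℂ))))
      (-p * Complex.exp (-(p * (t : ℂ)))) t := by
    intro t _
    refine (((hasDerivAt_id' t).ofReal_comp).const_mul p).fun_neg.cexp.congr_deriv ?_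
    simp
    ring
  have hv : ∀ t ∈ Ioi (0 : ℝ), HasDerivAt (fun t : ℝ => (G t : ℂ)) ((deriv G t : ℝ) : ℂ) t :=
    fun t ht => (hG.hasDerivAt ht).ofReal_comp
  have hparts := integral_Ioi_mul_deriv_eq_deriv_mul (a' := (G₀ : ℂ)) (b' := 0) hu hv
    (integrableOn_laplace_integrand (hG.integrableOn_deriv_and_integral hb).1 hp.le) ?_ ?_ ?_
  · have e1 : laplace (fun t => -deriv G t) p =
        -∫ t in Ioi (0 : ℝ), Complex.exp (-(p * (t : ℂ))) * ((deriv G t : ℝ) : ℂ) := by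
      rw [laplace, ← integral_neg]
      congr 1
      ext t
      push_cast
      ring
    have e2 : ∫ t in Ioi (0 : ℝ), -p * Complex.exp (-(p * (t : ℂ))) * (G t : ℂ) =
        -(p * laplace G p) := by
      rw [laplace, ← neg_mul, ← integral_const_mul]
      congr 1
      ext t
      ring
    rw [e1, hparts, e2, modulusQ]
    ring
  · refine (hI.const_mul (-p)).congr (Eventually.of_forall fun t => ?_)
    simp only [Pi.mul_apply]
    ring
  · have h1 : Tendsto (fun t : ℝ => Complex.exp (-(p * (t : ℂ)))) (𝓝[>] 0) (𝓝 1) := by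
      have : Continuous fun t : ℝ => Complex.exp (-(p * (t : ℂ))) := by fun_prop
      simpa using (this.tendsto 0).mono_left (nhdsWithin_le_nhds (s := Ioi 0))
    have h2 := (Complex.continuous_ofReal.tendsto _).comp (hG.tendsto_nhdsGT hb)
    rw [← one_mul (G₀ : ℂ)]
    exact h1.mul h2
  · refine squeeze_zero_norm' (a := fun t => Real.exp (-p.re * t) * G₀) ?_ ?_
    · filter_upwards [eventually_gt_atTop 0] with t ht using hle t ht
    · have : Tendsto (fun t : ℝ => Real.exp (-p.re * t)) atTop (𝓝 0) :=
        Real.tendsto_exp_atBot.comp (tendsto_id.const_mul_atTop_of_neg (by linarith))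
      simpa using this.mul_const G₀

end LICM

/-! ### Wave number and front factor of an abstract complex modulus -/

theorem sqrt_mul_self (z : ℂ) : Complex.sqrt z * Complex.sqrt z = z := by
  rw [← pow_two]
  exact Complex.cpow_nat_inv_pow z two_ne_zero

theorem sqrt_re_pos {z : ℂ} (hz : 0 < z.re) : 0 < (Complex.sqrt z).re := by
  rw [Complex.sqrt, Complex.cpow_inv_two_re]
  have := norm_nonneg z
  positivity

theorem norm_sqrt (z : ℂ) : ‖Complex.sqrt z‖ = Real.sqrt ‖z‖ := by
  rw [eq_comm, Real.sqrt_eq_iff_mul_self_eq (norm_nonneg _) (norm_nonneg _), ← norm_mul,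
    sqrt_mul_self]

/-- The analytic properties of a complex modulus with finite instantaneous value `g₀` that the
wavefront analysis needs. -/
structure IsComplexModulus (Q : ℂ → ℂ) (g₀ : ℝ) : Prop where
  pos : 0 < g₀
  continuousOn : ContinuousOn Q {p | 0 ≤ p.re}
  differentiableAt : ∀ p : ℂ, 0 < p.re → DifferentiableAt ℂ Q p
  re_pos : ∀ p : ℂ, 0 ≤ p.re → p ≠ 0 → 0 < (Q p).re
  im_mul_im_nonneg : ∀ p : ℂ, 0 ≤ p.re → 0 ≤ p.im * (Q p).im
  norm_sub_lt : ∀ δ : ℝ, 0 < δ → ∃ R : ℝ, 0 < R ∧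
    ∀ p : ℂ, 0 ≤ p.re → R ≤ ‖p‖ → ‖Q p - g₀‖ < δ
  eq_ofReal : ∀ x : ℝ, 0 < x → ∃ q : ℝ, Q x = q ∧ q ≤ g₀

/-- The wave number `ρ^{1/2} p / Q(p)^{1/2}` of a complex modulus `Q`. -/
noncomputable def waveNumberOf (ρ : ℝ) (Q : ℂ → ℂ) (p : ℂ) : ℂ :=
  (Real.sqrt ρ : ℂ) * p / Complex.sqrt (Q p)

/-- The function `[Q(p) κ(p)]⁻¹ e^{-(κ(p) - B p) r}` of a complex modulus `Q`. -/
noncomputable def frontFactorOf (ρ : ℝ) (Q : ℂ → ℂ) (B r : ℝ) (p : ℂ) : ℂ :=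
  (Q p * waveNumberOf ρ Q p)⁻¹ * Complex.exp (-((waveNumberOf ρ Q p - (B : ℂ) * p) * (r : ℂ)))

theorem re_waveNumberOf_ofReal {ρ x q : ℝ} {Q : ℂ → ℂ} (hq : 0 ≤ q) (h : Q x = q) :
    (waveNumberOf ρ Q x).re = Real.sqrt ρ * x / Real.sqrt q := by
  rw [waveNumberOf, h, Complex.sqrt_of_nonneg (by exact_mod_cast hq)]
  have : (Real.sqrt ρ : ℂ) * x / ((Real.sqrt (q : ℂ).re : ℝ) : ℂ) =
      ((Real.sqrt ρ * x / Real.sqrt q : ℝ) : ℂ) := by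
    push_cast
    rfl
  rw [this, Complex.ofReal_re]

namespace IsComplexModulus

variable {Q : ℂ → ℂ} {g₀ : ℝ} {ρ : ℝ}

theorem mem_slitPlane (H : IsComplexModulus Q g₀) {p : ℂ} (hp : 0 ≤ p.re) (hp0 : p ≠ 0) :
    Q p ∈ Complex.slitPlane := Or.inl (H.re_pos p hp hp0)

theorem ne_zero (H : IsComplexModulus Q g₀) {p : ℂ} (hp : 0 ≤ p.re) (hp0 : p ≠ 0) :
    Q p ≠ 0 := Complex.slitPlane_ne_zero (H.mem_slitPlane hp hp0)

theorem sqrt_ne_zero (H : IsComplexModulus Q g₀) {p : ℂ} (hp : 0 ≤ p.re) (hp0 : p ≠ 0) :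
    Complex.sqrt (Q p) ≠ 0 := fun h => H.ne_zero hp hp0 (by rw [← sqrt_mul_self (Q p), h, zero_mul])

theorem waveNumberOf_ne_zero (H : IsComplexModulus Q g₀) (hρ : 0 < ρ) {p : ℂ} (hp : 0 ≤ p.re)
    (hp0 : p ≠ 0) : waveNumberOf ρ Q p ≠ 0 :=
  div_ne_zero (mul_ne_zero (by exact_mod_cast (Real.sqrt_pos.2 hρ).ne') hp0)
    (H.sqrt_ne_zero hp hp0)

theorem differentiableAt_waveNumberOf (H : IsComplexModulus Q g₀) {p : ℂ} (hp : 0 < p.re) :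
    DifferentiableAt ℂ (waveNumberOf ρ Q) p := by
  have hp0 : p ≠ 0 := by rintro rfl; simp at hp
  have h1 : DifferentiableAt ℂ (fun z => Complex.sqrt (Q z)) p :=
    (Complex.differentiableAt_sqrt (H.mem_slitPlane hp.le hp0)).comp p (H.differentiableAt p hp)
  exact (differentiableAt_id.const_mul _).div h1 (H.sqrt_ne_zero hp.le hp0)

theorem differentiableAt_frontFactorOf (H : IsComplexModulus Q g₀) (hρ : 0 < ρ) (B r : ℝ) {p : ℂ}
    (hp : 0 < p.re) : DifferentiableAt ℂ (frontFactorOf ρ Q B r) p := by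
  have hp0 : p ≠ 0 := by rintro rfl; simp at hp
  have h1 := H.differentiableAt_waveNumberOf (ρ := ρ) hp
  refine DifferentiableAt.mul (DifferentiableAt.inv ((H.differentiableAt p hp).mul h1)
    (mul_ne_zero (H.ne_zero hp.le hp0) (H.waveNumberOf_ne_zero hρ hp.le hp0))) ?_
  exact ((h1.sub (differentiableAt_id.const_mul _)).mul_const _).neg.cexp

theorem continuousOn_waveNumberOf (H : IsComplexModulus Q g₀) :
    ContinuousOn (waveNumberOf ρ Q) {p | 0 ≤ p.re ∧ p ≠ 0} := by
  have hQ : ContinuousOn Q {p | 0 ≤ p.re ∧ p ≠ 0} := H.continuousOn.mono fun p hp => hp.1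
  have h1 : ContinuousOn (fun z => Complex.sqrt (Q z)) {p | 0 ≤ p.re ∧ p ≠ 0} :=
    Complex.differentiableOn_sqrt.continuousOn.comp hQ fun p hp => H.mem_slitPlane hp.1 hp.2
  exact (ContinuousOn.mul continuousOn_const continuousOn_id).div h1
    fun p hp => H.sqrt_ne_zero hp.1 hp.2

theorem continuousOn_frontFactorOf (H : IsComplexModulus Q g₀) (hρ : 0 < ρ) (B r : ℝ) :
    ContinuousOn (frontFactorOf ρ Q B r) {p | 0 ≤ p.re ∧ p ≠ 0} := by
  have hQ : ContinuousOn Q {p | 0 ≤ p.re ∧ p ≠ 0} := H.continuousOn.mono fun p hp => hp.1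
  have h1 := H.continuousOn_waveNumberOf (ρ := ρ)
  refine ContinuousOn.mul (ContinuousOn.inv₀ (hQ.mul h1) fun p hp =>
    mul_ne_zero (H.ne_zero hp.1 hp.2) (H.waveNumberOf_ne_zero hρ hp.1 hp.2)) ?_
  exact ((h1.sub (continuousOn_const.mul continuousOn_id)).mul continuousOn_const).neg.cexp

/-- With `s = √Q`, `Im Q = 2 Re s Im s` and `Re s > 0`, so `Im p · Im s ≥ 0`; both terms of `Re(p /
s) = (Re p Re s + Im p Im s) / |s|²` are then nonnegative. -/
theorem re_waveNumberOf_nonneg (H : IsComplexModulus Q g₀) {p : ℂ} (hp : 0 ≤ p.re)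
    (hp0 : p ≠ 0) : 0 ≤ (waveNumberOf ρ Q p).re := by
  have hre := sqrt_re_pos (H.re_pos p hp hp0)
  have him := H.im_mul_im_nonneg p hp
  set s := Complex.sqrt (Q p) with hs
  have hq : (Q p).im = 2 * s.re * s.im := by
    rw [← sqrt_mul_self (Q p), ← hs, Complex.mul_im]
    ring
  have hmul : 0 ≤ p.im * s.im := by
    rw [hq] at him
    by_contra hcon
    push Not at hcon
    nlinarith
  rw [waveNumberOf, ← hs, mul_div_assoc, Complex.re_ofReal_mul, Complex.div_re]
  have := Complex.normSq_nonneg s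
  have := hre.le
  refine mul_nonneg (Real.sqrt_nonneg _) ?_
  positivity

/-- The attenuation is nonnegative: a Phragmén-Lindelöf argument in shifted half-planes. -/
theorem mul_re_le_re_waveNumberOf (H : IsComplexModulus Q g₀) {p : ℂ}
    (hp : 0 ≤ p.re) (hp0 : p ≠ 0) :
    Real.sqrt ρ / Real.sqrt g₀ * p.re ≤ (waveNumberOf ρ Q p).re := by
  set B := Real.sqrt ρ / Real.sqrt g₀ with hB
  have hB0 : 0 ≤ B := by positivity
  have hne : ∀ {z : ℂ}, 0 < z.re → z ≠ 0 := by rintro z hz rfl; simp at hz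
  -- The shift makes the function holomorphic up to the boundary and avoids the origin, where `Q`
  -- may vanish.
  have key : ∀ δ : ℝ, 0 < δ → ∀ z : ℂ, 0 ≤ z.re → B * z.re ≤ (waveNumberOf ρ Q (z + δ)).re := by
    intro δ hδ z hz
    have hshift : ∀ w : ℂ, 0 ≤ w.re → 0 < (w + δ).re := fun w hw => by simp; linarith
    have hnorm : ∀ w : ℂ, ‖Complex.exp (-(waveNumberOf ρ Q (w + δ) - B * w))‖ =
        Real.exp (B * w.re - (waveNumberOf ρ Q (w + δ)).re) := by
      intro w
      rw [Complex.norm_exp]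
      simp
    have hPL := PhragmenLindelof.right_half_plane_of_bounded_on_real (C := 1)
      (f := fun w : ℂ => Complex.exp (-(waveNumberOf ρ Q (w + δ) - B * w))) (z := z)
      ?_ ?_ ?_ ?_ hz
    · rw [hnorm, Real.exp_le_one_iff] at hPL
      linarith
    · refine DifferentiableOn.diffContOnCl fun w hw => ?_
      rw [Complex.closure_setOfPred_lt_re] at hw
      have h1 : DifferentiableAt ℂ (fun w : ℂ => waveNumberOf ρ Q (w + δ)) w :=
        (H.differentiableAt_waveNumberOf (hshift w hw)).comp w
          (differentiableAt_id.add_const _)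
      exact (h1.sub (differentiableAt_id.const_mul _)).neg.cexp.differentiableWithinAt
    -- Order 1 is below the critical order 2; since `Re κ ≥ 0`, the modulus is at most `e^{B|w|}`.
    · refine ⟨1, by norm_num, B, Asymptotics.IsBigO.of_bound 1 ?_⟩
      refine Filter.Eventually.filter_mono inf_le_right ?_
      refine eventually_principal.2 fun w hw => ?_
      have hw' : 0 < w.re := hw
      rw [hnorm, Real.norm_eq_abs, Real.abs_exp, one_mul, Real.exp_le_exp, Real.rpow_one]
      have h1 := H.re_waveNumberOf_nonneg (ρ := ρ) (hshift w hw'.le).le (hne (hshift w hw'.le))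
      have h2 := mul_le_mul_of_nonneg_left (Complex.re_le_norm w) hB0
      linarith
    · refine isBoundedUnder_of_eventually_le (a := 1) ?_
      filter_upwards [eventually_ge_atTop 0] with x hx
      rw [hnorm, Real.exp_le_one_iff]
      have hxδ : 0 < x + δ := by linarith
      obtain ⟨q, hq, hqg⟩ := H.eq_ofReal (x + δ) hxδ
      have hq0 : 0 < q := by
        have := H.re_pos ((x + δ : ℝ) : ℂ) (by simpa using hxδ.le)
          (by exact_mod_cast hxδ.ne')
        rwa [hq, Complex.ofReal_re] at this
      have h1 := re_waveNumberOf_ofReal (ρ := ρ) hq0.le hq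
      rw [← Complex.ofReal_add, h1, Complex.ofReal_re]
      have h2 : B ≤ Real.sqrt ρ / Real.sqrt q :=
        div_le_div_of_nonneg_left (Real.sqrt_nonneg _) (Real.sqrt_pos.2 hq0)
          (Real.sqrt_le_sqrt hqg)
      rw [mul_div_right_comm]
      have h3 := mul_le_mul_of_nonneg_right h2 hxδ.le
      nlinarith
    · intro y
      rw [hnorm, Real.exp_le_one_iff]
      have h0 : (0 : ℝ) ≤ ((y : ℂ) * Complex.I).re := by simp
      have h1 := H.re_waveNumberOf_nonneg (ρ := ρ) (hshift _ h0).le (hne (hshift _ h0))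
      simpa using h1
  rcases hp.lt_or_eq with hp' | hp'
  -- With `z = p - δ` the right side is exactly `Re κ(p)`, so only the left side needs a limit.
  · have hlim : Tendsto (fun δ : ℝ => B * (p.re - δ)) (𝓝[>] 0) (𝓝 (B * p.re)) := by
      have : Continuous fun δ : ℝ => B * (p.re - δ) := by fun_prop
      simpa using (this.tendsto 0).mono_left (nhdsWithin_le_nhds (s := Ioi 0))
    refine le_of_tendsto hlim ?_
    filter_upwards [Ioo_mem_nhdsGT hp'] with δ hδ
    simpa using key δ hδ.1 (p - δ) (by simpa using hδ.2.le)
  · rw [← hp', mul_zero]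
    exact H.re_waveNumberOf_nonneg hp hp0

theorem norm_frontFactorOf_le (H : IsComplexModulus Q g₀) {r : ℝ} (hr : 0 ≤ r) {p : ℂ}
    (hp : 0 ≤ p.re) (hp0 : p ≠ 0) :
    ‖frontFactorOf ρ Q (Real.sqrt ρ / Real.sqrt g₀) r p‖ ≤
      (Real.sqrt ρ * ‖p‖ * Real.sqrt ‖Q p‖)⁻¹ := by
  have h1 : Q p * waveNumberOf ρ Q p = Real.sqrt ρ * p * Complex.sqrt (Q p) := by
    have hs := H.sqrt_ne_zero hp hp0
    rw [waveNumberOf]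
    nth_rewrite 1 [← sqrt_mul_self (Q p)]
    field_simp
  rw [frontFactorOf, norm_mul, h1, norm_inv, norm_mul, norm_mul, norm_sqrt, Complex.norm_real,
    Real.norm_of_nonneg (Real.sqrt_nonneg _)]
  refine mul_le_of_le_one_right (by positivity) ?_
  rw [Complex.norm_exp, Real.exp_le_one_iff, Complex.neg_re, Complex.re_mul_ofReal,
    Complex.sub_re, Complex.re_ofReal_mul]
  have := H.mul_re_le_re_waveNumberOf (ρ := ρ) hp hp0
  nlinarith

theorem norm_frontFactorOf_lt (H : IsComplexModulus Q g₀) (hρ : 0 < ρ) {r : ℝ} (hr : 0 ≤ r)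
    {δ : ℝ} (hδ : 0 < δ) : ∃ R : ℝ, 0 < R ∧ ∀ p : ℂ, 0 ≤ p.re → R ≤ ‖p‖ →
      ‖frontFactorOf ρ Q (Real.sqrt ρ / Real.sqrt g₀) r p‖ < δ := by
  have hg := H.pos
  obtain ⟨R₁, hR₁, hQ⟩ := H.norm_sub_lt (g₀ / 2) (by positivity)
  have hm : 0 < Real.sqrt ρ * Real.sqrt (g₀ / 2) :=
    mul_pos (Real.sqrt_pos.2 hρ) (Real.sqrt_pos.2 (by positivity))
  -- `R₁` ensures `|Q| ≥ g₀ / 2`; the second summand then makes `1 / (√ρ |p| √|Q|)` less than `δ`.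
  refine ⟨R₁ + (δ * (Real.sqrt ρ * Real.sqrt (g₀ / 2)))⁻¹, by positivity, fun p hp hR => ?_⟩
  have hinv : 0 < (δ * (Real.sqrt ρ * Real.sqrt (g₀ / 2)))⁻¹ := by positivity
  have hp1 : 0 < ‖p‖ := by linarith
  refine (H.norm_frontFactorOf_le hr hp (norm_pos_iff.1 hp1)).trans_lt ?_
  have h1 := hQ p hp (by linarith)
  have h2 : g₀ / 2 ≤ ‖Q p‖ := by
    have h3 := norm_sub_norm_le (g₀ : ℂ) (Q p)
    rw [norm_sub_rev, Complex.norm_real, Real.norm_of_nonneg hg.le] at h3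
    linarith
  have h3 := Real.sqrt_le_sqrt h2
  have h4 : (δ * (Real.sqrt ρ * Real.sqrt (g₀ / 2)))⁻¹ < ‖p‖ := by linarith
  rw [inv_lt_iff_one_lt_mul₀ (by positivity)] at h4
  have h5 : 0 < Real.sqrt (g₀ / 2) := Real.sqrt_pos.2 (by positivity)
  have h6 : 0 < Real.sqrt ρ := Real.sqrt_pos.2 hρ
  have h7 : 0 < Real.sqrt ‖Q p‖ := h5.trans_le h3
  rw [inv_lt_iff_one_lt_mul₀ (by positivity)]
  calc 1 < ‖p‖ * (δ * (Real.sqrt ρ * Real.sqrt (g₀ / 2))) := by linarith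
    _ ≤ ‖p‖ * (δ * (Real.sqrt ρ * Real.sqrt ‖Q p‖)) := by gcongr
    _ = _ := by ring

end IsComplexModulus

theorem LICM.isComplexModulus {G : ℝ → ℝ} (hG : LICM G) (hb : BddAbove (G '' Ioi 0))
    (hG0 : ∃ t : ℝ, 0 < t ∧ G t ≠ 0) :
    IsComplexModulus (fun p => (sSup (G '' Ioi 0) : ℝ) - laplace (fun t => -deriv G t) p)
      (sSup (G '' Ioi 0)) := by
  have D := hG.decreasingDensity hb
  have hpos : 0 < sSup (G '' Ioi 0) := by
    obtain ⟨t, ht, hne⟩ := hG0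
    exact ((hG.nonneg ht).lt_of_ne' hne).trans_le (LICM.le_sSup hb ht)
  refine ⟨hpos, continuousOn_const.sub (continuousOn_laplace D.integrableOn),
    fun p hp => (differentiableAt_laplace D.integrableOn hp).const_sub _, ?_, ?_, ?_, ?_⟩
  · intro p hp hp0
    rw [Complex.sub_re, Complex.ofReal_re, sub_pos]
    -- If `G` is not constant, `Re L(-G') < ∫ -G' ≤ G(0+)`. For constant `G` the strict bound is
    -- unavailable, but the transform is zero.
    by_cases hz : ∃ t, 0 < t ∧ -deriv G t ≠ 0
    · obtain ⟨t, ht, hne⟩ := hz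
      refine (D.re_laplace_lt hp hp0 ht hne).trans_le ?_
      rw [integral_neg]
      exact (hG.integrableOn_deriv_and_integral hb).2
    · push Not at hz
      have : laplace (fun t => -deriv G t) p = 0 := by
        rw [laplace]
        exact setIntegral_eq_zero_of_forall_eq_zero fun t ht => by rw [hz t ht]; simp
      rwa [this, Complex.zero_re]
  · intro p hp
    have := D.im_mul_im_laplace_nonpos hp
    rw [Complex.sub_im, Complex.ofReal_im]
    linarith
  · intro δ hδ
    obtain ⟨R, hR, h⟩ := D.norm_laplace_lt hG.continuousOn_deriv_deriv.neg hδ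
    exact ⟨R, hR, fun p hp hpR => by simpa using h p hp hpR⟩
  · intro x hx
    have h1 : laplace (fun t => -deriv G t) (x : ℂ) =
        ((∫ t in Ioi (0 : ℝ), Real.exp (-(x * t)) * -deriv G t : ℝ) : ℂ) := by
      rw [laplace, ← integral_complex_ofReal]
      congr 1
      ext t
      push_cast
      rfl
    refine ⟨sSup (G '' Ioi 0) - ∫ t in Ioi (0 : ℝ), Real.exp (-(x * t)) * -deriv G t,
      by rw [h1]; push_cast; rfl, ?_⟩
    have : 0 ≤ ∫ t in Ioi (0 : ℝ), Real.exp (-(x * t)) * -deriv G t :=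
      setIntegral_nonneg measurableSet_Ioi fun t ht =>
        mul_nonneg (Real.exp_pos _).le (D.nonneg t ht)
    linarith

/-! ### Closing the Bromwich contour -/

theorem integral_exp_neg_mul_le {a : ℝ} (ha : 0 < a) {s X : ℝ} (hs : 0 ≤ s) :
    ∫ x in s..X, Real.exp (-(a * x)) ≤ a⁻¹ := by
  have hd : ∀ x ∈ uIcc s X, HasDerivAt (fun x => -Real.exp (-(a * x)) / a)
      (Real.exp (-(a * x))) x := fun x _ => by
    refine ((((hasDerivAt_id' x).const_mul a).fun_neg.exp).fun_neg.div_const a).congr_deriv ?_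
    field_simp
  rw [intervalIntegral.integral_eq_sub_of_hasDerivAt hd
    (Continuous.intervalIntegrable (by fun_prop) _ _), ← sub_div, ← one_div]
  refine div_le_div_of_nonneg_right ?_ ha.le
  have h1 : Real.exp (-(a * s)) ≤ 1 := Real.exp_le_one_iff.2 (by nlinarith)
  have h2 := Real.exp_pos (-(a * X))
  linarith

/-- Closing the Bromwich contour on the right, by Cauchy's theorem on rectangles. -/
theorem hasBromwichIntegral_exp_mul_zero {F : ℂ → ℂ} {a ε : ℝ} (ha : 0 < a) (hε : 0 < ε)
    (hF : ∀ p : ℂ, 0 < p.re → DifferentiableAt ℂ F p)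
    (hdecay : ∀ δ : ℝ, 0 < δ → ∃ R : ℝ, 0 < R ∧ ∀ p : ℂ, 0 < p.re → R ≤ ‖p‖ → ‖F p‖ < δ) :
    HasBromwichIntegral ε (fun p => Complex.exp (-((a : ℂ) * p)) * F p) 0 := by
  rw [HasBromwichIntegral, Metric.tendsto_nhds]
  intro η hη
  -- Since `∫ e^{-ax} dx ≤ 1/a`, each horizontal side contributes at most `η / 4`, whatever its
  -- length. The two heights are never compared, so the ends may recede independently.
  obtain ⟨R, hR, hFR⟩ := hdecay (a * η / 4) (by positivity)
  set f : ℂ → ℂ := fun p => Complex.exp (-((a : ℂ) * p)) * F p with hf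
  have hfnorm : ∀ p : ℂ, 0 < p.re → R ≤ ‖p‖ →
      ‖f p‖ ≤ a * η / 4 * Real.exp (-(a * p.re)) := by
    intro p hp hpR
    have : ‖Complex.exp (-((a : ℂ) * p))‖ = Real.exp (-(a * p.re)) := by
      rw [Complex.norm_exp]; simp
    rw [hf, norm_mul, this, mul_comm]
    exact mul_le_mul_of_nonneg_right (hFR p hp hpR).le (Real.exp_pos _).le
  have hev : ∀ᶠ S : ℝ × ℝ in atTop ×ˢ atTop, R ≤ S.1 ∧ R ≤ S.2 :=
    (eventually_ge_atTop R).prod_mk (eventually_ge_atTop R)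
  filter_upwards [hev] with S hS
  obtain ⟨hS1, hS2⟩ := hS
  have hhor : ∀ y X : ℝ, R ≤ |y| → ε ≤ X →
      ‖∫ x in ε..X, f ((x : ℂ) + (y : ℂ) * Complex.I)‖ ≤ η / 4 := by
    intro y X hy hX
    have h1 := intervalIntegral.norm_integral_le_of_norm_le hX (μ := volume)
      (f := fun x : ℝ => f ((x : ℂ) + (y : ℂ) * Complex.I))
      (g := fun x => a * η / 4 * Real.exp (-(a * x)))
      (Eventually.of_forall fun x hx => ?_) (Continuous.intervalIntegrable (by fun_prop) _ _)
    · refine h1.trans ?_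
      rw [intervalIntegral.integral_const_mul]
      refine (mul_le_mul_of_nonneg_left (integral_exp_neg_mul_le ha hε.le)
        (by positivity)).trans (le_of_eq ?_)
      field_simp
    · have hx0 : 0 < x := hε.trans hx.1
      have hre : ((x : ℂ) + (y : ℂ) * Complex.I).re = x := by simp
      have him : ((x : ℂ) + (y : ℂ) * Complex.I).im = y := by simp
      have h2 := hfnorm ((x : ℂ) + (y : ℂ) * Complex.I) (by rwa [hre])
        (hy.trans (by simpa only [him] using
          Complex.abs_im_le_norm ((x : ℂ) + (y : ℂ) * Complex.I)))
      rwa [hre] at h2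
  have hver : ∀ X : ℝ, R ≤ X → ‖∫ y in (-S.1)..S.2, f ((X : ℂ) + (y : ℂ) * Complex.I)‖ ≤
      a * η / 4 * Real.exp (-(a * X)) * |S.2 - -S.1| := by
    intro X hX
    refine intervalIntegral.norm_integral_le_of_norm_le_const fun y _ => ?_
    have hre : ((X : ℂ) + (y : ℂ) * Complex.I).re = X := by simp
    have h2 := hfnorm ((X : ℂ) + (y : ℂ) * Complex.I) (by rw [hre]; linarith)
      (hX.trans (by simpa only [hre] using
        Complex.re_le_norm ((X : ℂ) + (y : ℂ) * Complex.I)))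
    rwa [hre] at h2
  set J := ∫ y in (-S.1)..S.2, f ((ε : ℂ) + (y : ℂ) * Complex.I) with hJ
  have hbound : ∀ X : ℝ, ε ≤ X → R ≤ X →
      ‖J‖ ≤ η / 2 + a * η / 4 * Real.exp (-(a * X)) * |S.2 - -S.1| := by
    intro X hX hXR
    have hrect := Complex.integral_boundary_rect_eq_zero_of_differentiableOn f
      ⟨ε, -S.1⟩ ⟨X, S.2⟩ ?_
    · have h1 := hhor (-S.1) X (by rw [abs_neg]; exact hS1.trans (le_abs_self _)) hX
      have h2 := hhor S.2 X (hS2.trans (le_abs_self _)) hX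
      have h3 := hver X hXR
      simp only [smul_eq_mul] at hrect
      rw [sub_eq_zero, ← hJ] at hrect
      have h4 : ‖Complex.I * J‖ = ‖J‖ := by simp
      rw [← h4, ← hrect]
      refine (norm_add_le _ _).trans (add_le_add ((norm_sub_le _ _).trans ?_) ?_)
      · linarith
      · simpa using h3
    · intro p hp
      have hp1 : p.re ∈ uIcc ε X := hp.1
      rw [uIcc_of_le hX] at hp1
      exact (DifferentiableAt.mul (differentiableAt_id.const_mul _).neg.cexp
        (hF p (hε.trans_le hp1.1))).differentiableWithinAt
  -- At fixed heights, the far vertical side disappears as `X → ∞`.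
  have hlim : Tendsto (fun X : ℝ => η / 2 + a * η / 4 * Real.exp (-(a * X)) * |S.2 - -S.1|)
      atTop (𝓝 (η / 2)) := by
    have h1 : Tendsto (fun X : ℝ => Real.exp (-(a * X))) atTop (𝓝 0) :=
      Real.tendsto_exp_neg_atTop_nhds_zero.comp (tendsto_id.const_mul_atTop ha)
    simpa using ((h1.const_mul (a * η / 4)).mul_const |S.2 - -S.1|).const_add (η / 2)
  have hJle : ‖J‖ ≤ η / 2 := by
    refine ge_of_tendsto hlim ?_
    filter_upwards [eventually_ge_atTop ε, eventually_ge_atTop R] with X h1 h2 using hbound X h1 h2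
  rw [dist_zero_right, intervalIntegral.integral_mul_const, norm_mul, Complex.norm_I, mul_one]
  simp only [mul_comm Complex.I]
  linarith

theorem HasBromwichIntegral.bromwich_eq {ε : ℝ} {F : ℂ → ℂ} {v : ℂ}
    (h : HasBromwichIntegral ε F v) : bromwich ε F = v :=
  Tendsto.limUnder_eq h

theorem HasBromwichIntegral.congr {ε : ℝ} {F₁ F₂ : ℂ → ℂ} {v : ℂ}
    (h : HasBromwichIntegral ε F₁ v) (hF : ∀ p : ℂ, p.re = ε → F₁ p = F₂ p) :
    HasBromwichIntegral ε F₂ v := by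
  refine Tendsto.congr (fun S => ?_) h
  congr 1
  ext y
  rw [hF _ (by simp)]

/-! ### Transfer to the relaxation modulus -/

theorem isOpen_rightHalfPlane : IsOpen rightHalfPlane :=
  isOpen_lt continuous_const Complex.continuous_re

theorem mem_closure_rightHalfPlane {p : ℂ} (hp : 0 ≤ p.re) : p ∈ closure rightHalfPlane := by
  rw [rightHalfPlane, Complex.closure_setOfPred_lt_re]
  exact hp

namespace LICM

variable {G : ℝ → ℝ} {ρ : ℝ}

theorem linearCoeff_eq (hG : LICM G) (hb : BddAbove (G '' Ioi 0))
    (hG0 : ∃ t : ℝ, 0 < t ∧ G t ≠ 0) :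
    linearCoeff ρ G = Real.sqrt ρ / Real.sqrt (sSup (G '' Ioi 0)) := by
  have H := hG.isComplexModulus hb hG0
  refine linearCoeff_eq_of_tendsto (fun x hx => hG.mul_integral_nonneg hx)
    (fun x _ => modulusQ_ofReal G x) ?_
  refine Tendsto.div tendsto_const_nhds ?_ (Real.sqrt_pos.2 H.pos).ne'
  refine (Real.continuous_sqrt.tendsto _).comp (Metric.tendsto_nhds.2 fun δ hδ => ?_)
  obtain ⟨R, hR, h⟩ := H.norm_sub_lt δ hδ
  filter_upwards [eventually_ge_atTop R] with x hx
  have hx0 : 0 < x := hR.trans_le hx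
  have h1 := h x (by simpa using hx0.le)
    (by rwa [Complex.norm_real, Real.norm_of_nonneg hx0.le])
  rw [← hG.modulusQ_eq hb (by simpa using hx0), modulusQ_ofReal, ← Complex.ofReal_sub,
    Complex.norm_real] at h1
  exact h1

/-- If the wavefront speed is finite, the modulus extends to the closed half-plane, and the linear
coefficient is determined by its value at infinity. -/
theorem exists_isComplexModulus (hG : LICM G) (hG0 : ∃ t : ℝ, 0 < t ∧ G t ≠ 0)
    (hB : linearCoeff ρ G ≠ 0) : ∃ (Q : ℂ → ℂ) (g₀ : ℝ), IsComplexModulus Q g₀ ∧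
      (∀ p : ℂ, 0 < p.re → modulusQ G p = Q p) ∧
      linearCoeff ρ G = Real.sqrt ρ / Real.sqrt g₀ := by
  have hb := hG.bddAbove_of_linearCoeff_ne_zero hB
  exact ⟨_, _, hG.isComplexModulus hb hG0, fun p hp => hG.modulusQ_eq hb hp,
    hG.linearCoeff_eq hb hG0⟩

end LICM

theorem waveNumber_eq_of_modulusQ_eq {ρ : ℝ} {G : ℝ → ℝ} {Q : ℂ → ℂ} {p : ℂ}
    (h : modulusQ G p = Q p) : waveNumber ρ G p = waveNumberOf ρ Q p := by
  rw [waveNumber, waveNumberOf, h]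

theorem frontFactor_eq_of_modulusQ_eq {ρ r : ℝ} {G : ℝ → ℝ} {Q : ℂ → ℂ} {p : ℂ}
    (h : modulusQ G p = Q p) :
    frontFactor ρ G r p = frontFactorOf ρ Q (linearCoeff ρ G) r p := by
  rw [frontFactor, frontFactorOf, dispAtt, waveNumber_eq_of_modulusQ_eq h, h]

/-- Splitting `κ = B p + β` isolates the exponential with rate `B|x| - t`, whose sign decides on
which side the contour closes. -/
theorem greenIntegrand_eq (ρ : ℝ) (G : ℝ → ℝ) (t x : ℝ) (p : ℂ) :
    greenIntegrand ρ G t x p =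
      Complex.exp (-(((linearCoeff ρ G * |x| - t : ℝ) : ℂ) * p)) *
        (ρ * frontFactor ρ G |x| p) := by
  have h : Complex.exp (-(((linearCoeff ρ G * |x| - t : ℝ) : ℂ) * p)) *
      Complex.exp (-(dispAtt ρ G p * ((|x| : ℝ) : ℂ))) =
      Complex.exp (p * (t : ℂ)) * Complex.exp (-(waveNumber ρ G p * ((|x| : ℝ) : ℂ))) := by
    rw [← Complex.exp_add, ← Complex.exp_add, dispAtt]
    congr 1
    push_cast
    ring
  rw [greenIntegrand, frontFactor, div_eq_mul_inv]
  linear_combination (-(ρ : ℂ) * (modulusQ G p * waveNumber ρ G p)⁻¹) * h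

section FrontFactor

variable {ρ g₀ : ℝ} {G : ℝ → ℝ} {Q : ℂ → ℂ}

theorem differentiableAt_frontFactor (hρ : 0 < ρ) (H : IsComplexModulus Q g₀)
    (hQ : ∀ p : ℂ, 0 < p.re → modulusQ G p = Q p) (r : ℝ) {p : ℂ} (hp : 0 < p.re) :
    DifferentiableAt ℂ (frontFactor ρ G r) p := by
  refine (H.differentiableAt_frontFactorOf hρ (linearCoeff ρ G) r hp).congr_of_eventuallyEq ?_
  filter_upwards [isOpen_rightHalfPlane.mem_nhds hp] with z hz
  exact frontFactor_eq_of_modulusQ_eq (hQ z hz)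

/-- The formula built from the continued `Q` is continuous up to the punctured imaginary axis, so it
supplies the limit that defines the extension. -/
theorem frontFactorExt_eq (hρ : 0 < ρ) (H : IsComplexModulus Q g₀)
    (hQ : ∀ p : ℂ, 0 < p.re → modulusQ G p = Q p) (r : ℝ) {p : ℂ} (hp : 0 ≤ p.re)
    (hp0 : p ≠ 0) :
    frontFactorExt ρ G r p = frontFactorOf ρ Q (linearCoeff ρ G) r p := by
  have hsub : rightHalfPlane ⊆ {p : ℂ | 0 ≤ p.re ∧ p ≠ 0} := fun z hz =>
    ⟨le_of_lt hz, by rintro rfl; simp [rightHalfPlane] at hz⟩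
  refine extendFrom_eq (mem_closure_rightHalfPlane hp) ?_
  refine Tendsto.congr' ?_
    ((H.continuousOn_frontFactorOf hρ (linearCoeff ρ G) r p ⟨hp, hp0⟩).mono hsub)
  filter_upwards [self_mem_nhdsWithin] with z hz
  exact (frontFactor_eq_of_modulusQ_eq (hQ z hz)).symm

theorem hasBromwichIntegral_greenIntegrand (hρ : 0 < ρ) (H : IsComplexModulus Q g₀)
    (hQ : ∀ p : ℂ, 0 < p.re → modulusQ G p = Q p)
    (hB : linearCoeff ρ G = Real.sqrt ρ / Real.sqrt g₀) {ε t x : ℝ} (hε : 0 < ε)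
    (ht : t < linearCoeff ρ G * |x|) :
    HasBromwichIntegral ε (greenIntegrand ρ G t x) 0 := by
  refine (hasBromwichIntegral_exp_mul_zero (sub_pos.2 ht) hε
    (F := fun p => ρ * frontFactor ρ G |x| p)
    (fun p hp => (differentiableAt_frontFactor hρ H hQ |x| hp).const_mul _) ?_).congr
    fun p _ => (greenIntegrand_eq ρ G t x p).symm
  intro δ hδ
  obtain ⟨R, hR, h⟩ := H.norm_frontFactorOf_lt hρ (abs_nonneg x) (div_pos hδ hρ)
  refine ⟨R, hR, fun p hp hpR => ?_⟩
  have h1 := h p hp.le hpR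
  rw [← hB, ← frontFactor_eq_of_modulusQ_eq (hQ p hp), lt_div_iff₀ hρ] at h1
  rw [norm_mul, Complex.norm_real, Real.norm_of_nonneg hρ.le, mul_comm]
  exact h1

end FrontFactor

theorem linearCoeff_pos_of_wavefrontSpeed_lt_top {ρ : ℝ} {G : ℝ → ℝ}
    (hc : wavefrontSpeed ρ G < ⊤) : 0 < linearCoeff ρ G := by
  rwa [wavefrontSpeed, ENNReal.inv_lt_top, ENNReal.ofReal_pos] at hc

theorem div_wavefrontSpeed_toReal {ρ : ℝ} {G : ℝ → ℝ} (hB : 0 ≤ linearCoeff ρ G) (x : ℝ) :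
    x / (wavefrontSpeed ρ G).toReal = linearCoeff ρ G * x := by
  rw [wavefrontSpeed, ENNReal.toReal_inv, ENNReal.toReal_ofReal hB, div_inv_eq_mul, mul_comm]

end Viscoelastic

theorem mainTheorem3 (ρ : ℝ) (hρ : 0 < ρ) (G : ℝ → ℝ) (hG : Viscoelastic.LICM G)
    (hG0 : ∃ t : ℝ, 0 < t ∧ G t ≠ 0) (hc : Viscoelastic.wavefrontSpeed ρ G < ⊤) :
    (∀ r : ℝ, 0 ≤ r →
      AnalyticOnNhd ℂ (Viscoelastic.frontFactor ρ G r) Viscoelastic.rightHalfPlane ∧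
      (∀ p ∈ Viscoelastic.rightHalfPlane,
        Viscoelastic.frontFactorExt ρ G r p = Viscoelastic.frontFactor ρ G r p) ∧
      ContinuousOn (Viscoelastic.frontFactorExt ρ G r) {p : ℂ | 0 ≤ p.re ∧ p ≠ 0} ∧
      (∀ δ : ℝ, 0 < δ → ∃ R : ℝ, 0 < R ∧ ∀ p : ℂ, 0 ≤ p.re → R ≤ ‖p‖ →
        ‖Viscoelastic.frontFactorExt ρ G r p‖ < δ)) ∧
    (∀ ε : ℝ, 0 < ε → ∀ t x : ℝ, t < |x| / (Viscoelastic.wavefrontSpeed ρ G).toReal →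
      Viscoelastic.HasBromwichIntegral ε (Viscoelastic.greenIntegrand ρ G t x) 0 ∧
      Viscoelastic.greenOneD ρ G ε t x = 0) ∧
    (∀ ε : ℝ, 0 < ε → ∀ (t : ℝ) (x : EuclideanSpace ℝ (Fin 3)), x ≠ 0 →
      t < ‖x‖ / (Viscoelastic.wavefrontSpeed ρ G).toReal →
      DifferentiableAt ℝ (fun r : ℝ => Viscoelastic.greenOneD ρ G ε t r) ‖x‖ ∧
      Viscoelastic.greenThreeD ρ G ε t x = 0) := by
  have hB0 := Viscoelastic.linearCoeff_pos_of_wavefrontSpeed_lt_top hc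
  obtain ⟨Q, g₀, H, hQ, hB⟩ := hG.exists_isComplexModulus hG0 hB0.ne'
  have hgreen : ∀ ε : ℝ, 0 < ε → ∀ t x : ℝ, t < Viscoelastic.linearCoeff ρ G * |x| →
      Viscoelastic.HasBromwichIntegral ε (Viscoelastic.greenIntegrand ρ G t x) 0 ∧
      Viscoelastic.greenOneD ρ G ε t x = 0 := fun ε hε t x ht => by
    have h := Viscoelastic.hasBromwichIntegral_greenIntegrand hρ H hQ hB hε ht
    exact ⟨h, by rw [Viscoelastic.greenOneD, h.bromwich_eq, mul_zero]⟩
  simp only [Viscoelastic.div_wavefrontSpeed_toReal hB0.le]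
  refine ⟨fun r hr => ⟨?_, fun p hp => ?_, ?_, fun δ hδ => ?_⟩, hgreen,
    fun ε hε t x hx ht => ?_⟩
  · refine DifferentiableOn.analyticOnNhd (fun p hp => ?_) Viscoelastic.isOpen_rightHalfPlane
    exact (Viscoelastic.differentiableAt_frontFactor hρ H hQ r hp).differentiableWithinAt
  · rw [Viscoelastic.frontFactor_eq_of_modulusQ_eq (hQ p hp)]
    exact Viscoelastic.frontFactorExt_eq hρ H hQ r (le_of_lt hp)
      (by rintro rfl; simp [Viscoelastic.rightHalfPlane] at hp)
  · exact (H.continuousOn_frontFactorOf hρ (Viscoelastic.linearCoeff ρ G) r).congr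
      fun p hp => Viscoelastic.frontFactorExt_eq hρ H hQ r hp.1 hp.2
  · obtain ⟨R, hR, h⟩ := H.norm_frontFactorOf_lt hρ hr hδ
    refine ⟨R, hR, fun p hp hpR => ?_⟩
    rw [Viscoelastic.frontFactorExt_eq hρ H hQ r hp (norm_pos_iff.1 (hR.trans_le hpR)), hB]
    exact h p hp hpR
  -- `t < B|r|` is an open condition on `r`, so the one-dimensional function vanishes near `r =
  -- ‖x‖`.
  · have hev : (fun r : ℝ => Viscoelastic.greenOneD ρ G ε t r) =ᶠ[𝓝 ‖x‖] fun _ => 0 := by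
      have hopen : IsOpen {r : ℝ | t < Viscoelastic.linearCoeff ρ G * |r|} :=
        isOpen_lt continuous_const (by fun_prop)
      filter_upwards [hopen.mem_nhds (by simpa using ht)] with r hr
      exact (hgreen ε hε t r hr).2
    refine ⟨(differentiableAt_const 0).congr_of_eventuallyEq hev, ?_⟩
    rw [Viscoelastic.greenThreeD, hev.deriv_eq, deriv_const, mul_zero, neg_zero]
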